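/- Let $n\ge 3$ and let $(X,Y)$ be a scalar product of signature $(n+1,1)$ on $\mathbb R^{n+2}$. The conformal space $C^n$ is the hyperquadric $(X,X)=0$ in the projective space $P(\mathbb R^{n+2})$; its hyperspheres are the points $B$ of $P(\mathbb R^{n+2})$ with $(B,B)>0$, and the point $X$ lies on $B$ if $(X,B)=0$. Let $V$ be a smooth immersed hypersurface of $C^n$ (of dimension $n-1$), locally given by a smooth nowhere zero map $A_0$ into the null cone of $\mathbb R^{n+2}$ with $dA_0$ injective modulo $A_0$. A hypersphere $B$ is tangent to $V$ at $x$ if $(A_0,B)=0$ and $(dA_0,B)=0$ at $x$. For a smooth local field $A_n$ of tangent hyperspheres, normalized by $(A_n,A_n)=1$, put $$g=(dA_0,dA_0)=g_{ij}\omega^i\omega^j,\qquad \lambda_{ij}\omega^i\omega^j=-(dA_0,dA_n)=(d^2A_0,A_n),\qquad a_{ij}=\lambda_{ij}-\tfrac1{n-1}\,(g^{kl}\lambda_{kl})\,g_{ij}.$$ The eigenvalues of the tensor $a_{ij}$ are the roots $s$ of $\det(a_{ij}-s\,g_{ij})=0$. (Another choice of $A_0$ and $A_n$ multiplies all of them by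 the same nowhere zero function, and does not change their multiplicities and eigenspaces.) For $m\ge1$ let $r=n-m-1\ge0$. The hypersurface $V$ is called an *$m$-canal hypersurface* if it is the envelope of an $r$-parameter family of hyperspheres, that is, if there is a field $x\mapsto S_x$ of hyperspheres on $V$, with $S_x$ tangent to $V$ at $x$ for every $x$, such that near every point of $V$ one can write $S_x=b(u(x))$, where $u$ is a smooth submersion onto an open subset of $\mathbb R^r$ and $b$ is a smooth immersion of this subset into the space $\{B : (B,B)=1\}$ of normalized hyperspheres. We say that $a_{ij}$ has an *eigenvalue of multiplicity $m$* if there is a field $x\mapsto L_x\subset T_xV$ of subspaces such that near every point of $V$, for some choice of $A_0$ and $A_n$, there is a continuous function $a$ whose value at every point $x$ is an eigenvalue of $a_{ij}$ of multiplicity exactly $m$ with eigenspace $L_x$. **Theorem 1.** Let $2\le m\le n-1$. Then $V$ is an $m$-canal hypersurface if and only if its tensor $a_{ij}$ has an eigenvalue of multiplicity $m$. -/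

import Mathlib

open scoped Manifold ContDiff

namespace Conformal

/-- The space of polyspherical coordinates of the `n`-dimensional conformal space. -/
abbrev PolySpace (n : ℕ) : Type := EuclideanSpace ℝ (Fin (n + 2))

/-- The fundamental scalar product, of signature `(n + 1, 1)`. -/
def form {n : ℕ} (X Y : PolySpace n) : ℝ :=
  (∑ i : Fin (n + 1), X i.castSucc * Y i.castSucc) - X (Fin.last (n + 1)) * Y (Fin.last (n + 1))

/-- The vector `X` is a (nonzero) vector of homogeneous coordinates of `p`. -/
def Represents {n : ℕ} (X : PolySpace n) (p : Projectivization ℝ (PolySpace n)) : Prop :=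
  ∃ h : X ≠ 0, Projectivization.mk ℝ X h = p

/-- The points of the conformal space `C^n`: the points of the hyperquadric `(X, X) = 0` in the
projective space of dimension `n + 1`. -/
def Point (n : ℕ) : Type := {p : Projectivization ℝ (PolySpace n) // form p.rep p.rep = 0}

/-- The hyperspheres of `C^n`: the points `X` of the projective space with `(X, X) > 0`.
A point `X` lies on the hypersphere `Y` if `(X, Y) = 0`. -/
def Hypersphere (n : ℕ) : Type := {p : Projectivization ℝ (PolySpace n) // 0 < form p.rep p.rep}

section Hypersurface

variable {n : ℕ} {M : Type*} [TopologicalSpace M] [ChartedSpace (EuclideanSpace ℝ (Fin (n - 1))) M]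

/-- The differential at `x` of a function `A` on the hypersurface with values in the space of
polyspherical coordinates. -/
noncomputable def diff (A : M → PolySpace n) (x : M) (v : TangentSpace (𝓡 (n - 1)) x) :
    PolySpace n :=
  mfderiv (𝓡 (n - 1)) 𝓘(ℝ, PolySpace n) A x v

/-- `A₀` is, on the open set `W`, a smooth field of homogeneous coordinates of the point `V x`, and
`V` is an immersion on `W` (the differential of `A₀` is injective modulo `A₀`). -/
structure IsLift (V : M → Point n) (W : Set M) (A₀ : M → PolySpace n) : Prop where
  isOpen : IsOpen W
  smooth : ContMDiffOn (𝓡 (n - 1)) 𝓘(ℝ, PolySpace n) ∞ A₀ W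
  represents : ∀ x ∈ W, Represents (A₀ x) (V x).val
  immersion : ∀ x ∈ W, ∀ v : TangentSpace (𝓡 (n - 1)) x,
    diff A₀ x v ∈ Submodule.span ℝ {A₀ x} → v = 0

/-- `V : M → C^n` is a (smooth, immersed) hypersurface of the conformal space. -/
def IsHypersurface (V : M → Point n) : Prop :=
  ∀ x : M, ∃ (W : Set M) (A₀ : M → PolySpace n), x ∈ W ∧ IsLift V W A₀

/-- The hypersphere `H` passes through the point `V x` and is tangent to `V` there. -/
def IsTangentAt (V : M → Point n) (H : Hypersphere n) (x : M) : Prop :=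
  ∃ (W : Set M) (A₀ : M → PolySpace n), x ∈ W ∧ IsLift V W A₀ ∧
    form (H.val.rep) (A₀ x) = 0 ∧
    ∀ v : TangentSpace (𝓡 (n - 1)) x, form (H.val.rep) (diff A₀ x v) = 0

/-- The elements `A₀` (the point) and `Aₙ` (a normalized tangent hypersphere) of a smooth field of
conformal frames on the open set `W`. -/
structure IsFrame (V : M → Point n) (W : Set M) (A₀ Aₙ : M → PolySpace n) : Prop where
  lift : IsLift V W A₀
  smooth : ContMDiffOn (𝓡 (n - 1)) 𝓘(ℝ, PolySpace n) ∞ Aₙ W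
  unit : ∀ x ∈ W, form (Aₙ x) (Aₙ x) = 1
  incident : ∀ x ∈ W, form (A₀ x) (Aₙ x) = 0
  tangent : ∀ x ∈ W, ∀ v : TangentSpace (𝓡 (n - 1)) x, form (diff A₀ x v) (Aₙ x) = 0

/-- The standard basis of the tangent space at `x` (the coordinate basis of the preferred chart). -/
noncomputable def basisVec (x : M) (i : Fin (n - 1)) : TangentSpace (𝓡 (n - 1)) x :=
  (EuclideanSpace.single i (1 : ℝ) : EuclideanSpace ℝ (Fin (n - 1)))

/-- The tensor `g = (dA₀, dA₀)`. -/
noncomputable def gTensor (A₀ : M → PolySpace n) (x : M) : Matrix (Fin (n - 1)) (Fin (n - 1)) ℝ :=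
  Matrix.of fun i j => form (diff A₀ x (basisVec x i)) (diff A₀ x (basisVec x j))

/-- The second order object `λ = (d²A₀, Aₙ) = -(dA₀, dAₙ)`. -/
noncomputable def lamTensor (A₀ Aₙ : M → PolySpace n) (x : M) :
    Matrix (Fin (n - 1)) (Fin (n - 1)) ℝ :=
  Matrix.of fun i j => -form (diff A₀ x (basisVec x i)) (diff Aₙ x (basisVec x j))

/-- The tensor `a_ij = λ_ij - λ g_ij`, where `λ = g^ij λ_ij / (n - 1)`. -/
noncomputable def aTensor (A₀ Aₙ : M → PolySpace n) (x : M) :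
    Matrix (Fin (n - 1)) (Fin (n - 1)) ℝ :=
  lamTensor A₀ Aₙ x -
    (((n : ℝ) - 1)⁻¹ * Matrix.trace ((gTensor A₀ x)⁻¹ * lamTensor A₀ Aₙ x)) • gTensor A₀ x

/-- The affinor `a^i_j = g^ik a_kj`. Its eigenvalues are the roots of `det (a_ij - s g_ij) = 0`;
they are called the eigenvalues of the tensor `a_ij`. -/
noncomputable def affinor (A₀ Aₙ : M → PolySpace n) (x : M) :
    Matrix (Fin (n - 1)) (Fin (n - 1)) ℝ :=
  (gTensor A₀ x)⁻¹ * aTensor A₀ Aₙ x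

/-- The tensor `a_ij` of `V` has an eigenvalue of multiplicity `m`: there is a field `L` of
subspaces of the tangent spaces such that near every point, in some smooth field of frames, there is
a continuous function `a` whose value at each point is an eigenvalue of multiplicity exactly `m`
with the space of principal directions `L`. (The eigenvalue itself is a relative quantity: another
frame multiplies it by a nonzero factor. The spaces `L` express without reference to frames that
it is the same eigenvalue on all of `V`.) -/
def HasEigenvalueOfMultiplicity (V : M → Point n) (m : ℕ) : Prop :=
  ∃ L : (x : M) → Submodule ℝ (TangentSpace (𝓡 (n - 1)) x),
    ∀ x : M, ∃ (W : Set M) (A₀ Aₙ : M → PolySpace n) (a : M → ℝ),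
      x ∈ W ∧ IsFrame V W A₀ Aₙ ∧ ContinuousOn a W ∧
      ∀ y ∈ W, (affinor A₀ Aₙ y).charpoly.rootMultiplicity (a y) = m ∧
        ∀ v : EuclideanSpace ℝ (Fin (n - 1)),
          (v : TangentSpace (𝓡 (n - 1)) y) ∈ L y ↔
            (affinor A₀ Aₙ y).mulVec v.ofLp = a y • v.ofLp

/-- On the open set `W` the hyperspheres `S x` are the members of a smooth `r`-parameter family
`b` of hyperspheres (normalized by `(b, b) = 1`, and depending on its `r` parameters essentially:
`b` is an immersion), the parameters `u x` being a submersion of `W`. -/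
def IsParameterFamilyOn (r : ℕ) (S : M → Hypersphere n) (W : Set M) : Prop :=
  ∃ (U : Set (EuclideanSpace ℝ (Fin r))) (b : EuclideanSpace ℝ (Fin r) → PolySpace n)
    (u : M → EuclideanSpace ℝ (Fin r)),
    IsOpen U ∧ ContDiffOn ℝ ∞ b U ∧ (∀ t ∈ U, form (b t) (b t) = 1) ∧
    (∀ t ∈ U, Function.Injective (fderiv ℝ b t)) ∧
    ContMDiffOn (𝓡 (n - 1)) (𝓡 r) ∞ u W ∧ Set.MapsTo u W U ∧
    (∀ x ∈ W, Function.Surjective (mfderiv (𝓡 (n - 1)) (𝓡 r) u x)) ∧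
    ∀ x ∈ W, Represents (b (u x)) (S x).val

/-- `V` is the envelope of an `r`-parameter family of hyperspheres: at every point `x` it is tangent
to a member `S x` of the family, and the field `S` depends, locally, on exactly `r` parameters. -/
def IsEnvelope (V : M → Point n) (r : ℕ) : Prop :=
  ∃ S : M → Hypersphere n, (∀ x : M, IsTangentAt V (S x) x) ∧
    ∀ x : M, ∃ W : Set M, x ∈ W ∧ IsOpen W ∧ IsParameterFamilyOn r S W

/-- `V` is an `m`-canal hypersurface: the envelope of an `(n - m - 1)`-parameter family. -/
def IsCanal (V : M → Point n) (m : ℕ) : Prop := IsEnvelope V (n - m - 1)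

end Hypersurface

end Conformal

/-! Write `A` for the point field and `B` for a normalized field of tangent hyperspheres. At each
point the normalized tangent hyperspheres are, up to sign, `B + μ A` with `μ` real, and the second
fundamental form `-(dA, d(B + μ A))` equals `λ - μ g`: the term containing `dμ` disappears because
`(dA, A) = 0`. As `g` is positive definite, algebraic and geometric multiplicities agree, and the
trace term in `a_ij` only shifts eigenvalues. So an eigenvalue of multiplicity `m` is the same thing
as a field of tangent hyperspheres whose second fundamental form has an `m`-dimensional kernel.

For `v` in this kernel, `dB(v)` is orthogonal to `A`, to `dA` and to `B`, hence `dB(v) = c A`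
(`IsAdapted.mem_span`). The heart of both implications is that `c = 0`, so that the kernel of the
form is the kernel of `dB`; the reasons differ.

From an eigenvalue to a canal hypersurface. The implicit function theorem makes the eigenvalue, and
with it the field `B`, smooth (`contDiffAt_eigenvalue`). A family of symmetric forms of constant
rank has a derivative that vanishes on pairs of kernel vectors (`deriv_symm_apply_ker`). If `m ≥ 2`,
the kernel contains `w ≠ 0` orthogonal to `v`; comparing the derivative along `w` at `(w, v)` with
the derivative along `v` at `(w, w)`, and using the symmetry of `d²B`, gives `c g(w, w) = 0`
(`IsCoordFrame.fderiv_sphere_eq_zero`). Now `dB` has constant rank `r`, and the constant rank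
theorem writes `B` as an immersion of `r` parameters after a submersion. The local fields agree up
to sign, because a common kernel vector determines the hypersphere
(`IsCoordFrame.sphere_eq_or_eq_neg`).

From a canal hypersurface to an eigenvalue. Let `B = b ∘ u`. Along a fibre of `u` the image of `db`
is fixed, and every point `A` of the fibre is orthogonal to it. If `c ≠ 0`, this image contains
`A(y)`, so the null vectors `A` along the fibre are orthogonal to the null vector `A(y)`, hence
proportional to it, against the immersion property (`IsCoordFrame.fderiv_comp_eq_zero`). So the
kernel of the form is `ker dB = ker du`, of dimension `m`. -/

namespace Conformal

/-! ### Linear algebra of the scalar product of signature `(n + 1, 1)` -/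

section FormAlgebra

variable {n : ℕ}

/-- The fundamental scalar product as a bilinear form. -/
def formB (n : ℕ) : LinearMap.BilinForm ℝ (PolySpace n) :=
  LinearMap.mk₂ ℝ form
    (fun X Y Z => by simp only [form, PiLp.add_apply, add_mul, Finset.sum_add_distrib]; ring)
    (fun c X Y => by
      simp only [form, PiLp.smul_apply, smul_eq_mul, mul_sub, Finset.mul_sum, mul_assoc])
    (fun X Y Z => by simp only [form, PiLp.add_apply, mul_add, Finset.sum_add_distrib]; ring)
    (fun c X Y => by
      simp only [form, PiLp.smul_apply, smul_eq_mul, mul_sub, Finset.mul_sum]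
      congr 1
      · exact Finset.sum_congr rfl fun _ _ => by ring
      · ring)

/-- The fundamental scalar product as a continuous bilinear map. -/
noncomputable def formL (n : ℕ) : PolySpace n →L[ℝ] PolySpace n →L[ℝ] ℝ :=
  LinearMap.toContinuousLinearMap
    ((LinearMap.toContinuousLinearMap : (PolySpace n →ₗ[ℝ] ℝ) ≃ₗ[ℝ] _).toLinearMap ∘ₗ formB n)

theorem formB_apply (X Y : PolySpace n) : formB n X Y = form X Y := rfl

theorem form_comm (X Y : PolySpace n) : form X Y = form Y X := by
  simp only [form, mul_comm]

@[simp] theorem form_add_left (X Y Z : PolySpace n) : form (X + Y) Z = form X Z + form Y Z := by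
  simp only [← formB_apply, map_add, LinearMap.add_apply]

@[simp] theorem form_add_right (X Y Z : PolySpace n) : form X (Y + Z) = form X Y + form X Z := by
  simp only [← formB_apply, map_add]

@[simp] theorem form_smul_left (c : ℝ) (X Y : PolySpace n) : form (c • X) Y = c * form X Y := by
  simp only [← formB_apply, map_smul, LinearMap.smul_apply, smul_eq_mul]

@[simp] theorem form_smul_right (c : ℝ) (X Y : PolySpace n) : form X (c • Y) = c * form X Y := by
  simp only [← formB_apply, map_smul, smul_eq_mul]

@[simp] theorem form_zero_left (X : PolySpace n) : form 0 X = 0 := by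
  simp only [← formB_apply, map_zero, LinearMap.zero_apply]

@[simp] theorem form_zero_right (X : PolySpace n) : form X 0 = 0 := by
  simp only [← formB_apply, map_zero]

@[simp] theorem form_sub_right (X Y Z : PolySpace n) : form X (Y - Z) = form X Y - form X Z := by
  simp only [← formB_apply, map_sub]

/-- The only negative square of the form sits in the last coordinate; without it a null vector has
Euclidean length zero. -/
theorem last_ne_zero_of_null {A : PolySpace n} (hA : A ≠ 0) (h0 : form A A = 0) :
    A (Fin.last (n + 1)) ≠ 0 := by
  intro h
  apply hA
  simp only [form, h, mul_zero, sub_zero] at h0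
  rw [Finset.sum_eq_zero_iff_of_nonneg (fun i _ => mul_self_nonneg _)] at h0
  ext i
  refine Fin.lastCases h (fun j => ?_) i
  exact mul_self_eq_zero.mp (h0 j (Finset.mem_univ _))

/-- The form is a sum of squares on the orthogonal complement of a null vector. -/
theorem form_self_eq_sum_sq {A X : PolySpace n} (hA : A ≠ 0) (h0 : form A A = 0)
    (hX : form A X = 0) :
    form X X = ∑ i : Fin (n + 1),
      (X i.castSucc - X (Fin.last (n + 1)) / A (Fin.last (n + 1)) * A i.castSucc) ^ 2 := by
  have hl := last_ne_zero_of_null hA h0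
  set α := A (Fin.last (n + 1)) with hα
  set ξ := X (Fin.last (n + 1)) with hξ
  have e1 : ∑ i : Fin (n + 1), A i.castSucc * A i.castSucc = α * α := by
    simpa [form, sub_eq_zero] using h0
  have e2 : ∑ i : Fin (n + 1), A i.castSucc * X i.castSucc = α * ξ := by
    simpa [form, sub_eq_zero] using hX
  -- The vector `X - (ξ / α) A` has last coordinate zero and the same square as `X`, since `A` is
  -- null and orthogonal to `X`.
  have e3 : ∀ i : Fin (n + 1), (X i.castSucc - ξ / α * A i.castSucc) ^ 2
      = X i.castSucc * X i.castSucc - 2 * (ξ / α) * (A i.castSucc * X i.castSucc)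
        + (ξ / α) ^ 2 * (A i.castSucc * A i.castSucc) := fun i => by ring
  simp only [e3, Finset.sum_add_distrib, Finset.sum_sub_distrib, ← Finset.mul_sum, e1, e2, form]
  field_simp
  ring

theorem form_self_nonneg_of_orthogonal_null {A X : PolySpace n} (hA : A ≠ 0) (h0 : form A A = 0)
    (hX : form A X = 0) : 0 ≤ form X X := by
  rw [form_self_eq_sum_sq hA h0 hX]
  exact Finset.sum_nonneg fun i _ => sq_nonneg _

theorem mem_span_of_orthogonal_null {A X : PolySpace n} (hA : A ≠ 0) (h0 : form A A = 0)
    (hX : form A X = 0) (hXX : form X X = 0) : X ∈ Submodule.span ℝ {A} := by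
  have hl := last_ne_zero_of_null hA h0
  rw [form_self_eq_sum_sq hA h0 hX,
    Finset.sum_eq_zero_iff_of_nonneg (fun i _ => sq_nonneg _)] at hXX
  refine Submodule.mem_span_singleton.mpr
    ⟨X (Fin.last (n + 1)) / A (Fin.last (n + 1)), ?_⟩
  ext i
  refine Fin.lastCases ?_ (fun j => ?_) i
  · simp [div_mul_cancel₀ _ hl]
  · have := pow_eq_zero_iff (two_ne_zero) |>.mp (hXX j (Finset.mem_univ _))
    simp only [PiLp.smul_apply, smul_eq_mul]
    linarith

theorem formB_nondegenerate : (formB n).Nondegenerate := by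
  have key : ∀ X : PolySpace n, (∀ Y, form X Y = 0) → X = 0 := by
    intro X hX
    ext i
    refine Fin.lastCases ?_ (fun j => ?_) i
    · have := hX (EuclideanSpace.single (Fin.last (n + 1)) 1)
      simpa [form, Fin.castSucc_ne_last] using this
    · have := hX (EuclideanSpace.single j.castSucc 1)
      simpa [form, (Fin.castSucc_ne_last j).symm] using this
  refine ⟨fun X hX => key X fun Y => hX Y, fun X hX => key X fun Y => ?_⟩
  rw [form_comm]
  exact hX Y

/-- A point `A`, tangent vectors `P v` and a normalized tangent hypersphere `B`, at one point
of a hypersurface. -/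
structure IsAdapted {E : Type*} [AddCommGroup E] [Module ℝ E] (A : PolySpace n)
    (P : E →ₗ[ℝ] PolySpace n) (B : PolySpace n) : Prop where
  ne_zero : A ≠ 0
  null : form A A = 0
  injective : ∀ v, P v ∈ Submodule.span ℝ {A} → v = 0
  orthogonal : ∀ v, form A (P v) = 0
  unit : form B B = 1
  incident : form A B = 0
  tangent : ∀ v, form (P v) B = 0

namespace IsAdapted

variable {E : Type*} [AddCommGroup E] [Module ℝ E] {A B : PolySpace n} {P : E →ₗ[ℝ] PolySpace n}

theorem pos (h : IsAdapted A P B) {v : E} (hv : v ≠ 0) : 0 < form (P v) (P v) := by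
  refine lt_of_le_of_ne (form_self_nonneg_of_orthogonal_null h.ne_zero h.null (h.orthogonal v))
    fun h0 => hv (h.injective v ?_)
  exact mem_span_of_orthogonal_null h.ne_zero h.null (h.orthogonal v) h0.symm

/-- The vectors `A`, `P v`, `B` span a hyperplane of the `(n + 2)`-dimensional space. Its orthogonal
complement is a line, and this line already contains `A`. -/
theorem mem_span (h : IsAdapted A P B) [FiniteDimensional ℝ E] (hn : 1 ≤ n)
    (hE : Module.finrank ℝ E = n - 1) {X : PolySpace n} (hA : form A X = 0)
    (hP : ∀ v, form (P v) X = 0) (hB : form B X = 0) : X ∈ Submodule.span ℝ {A} := by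
  let Θ : (ℝ × E × ℝ) →ₗ[ℝ] PolySpace n :=
    (LinearMap.toSpanSingleton ℝ _ A).coprod (P.coprod (LinearMap.toSpanSingleton ℝ _ B))
  have hΘ : ∀ a v b, Θ (a, v, b) = a • A + (P v + b • B) := fun a v b => rfl
  have hinj : Function.Injective Θ := by
    rw [← LinearMap.ker_eq_bot, LinearMap.ker_eq_bot']
    rintro ⟨a, v, b⟩ h0
    rw [hΘ] at h0
    -- Pairing with `B` isolates `b`; the injectivity of `P` modulo `A` then gives `v = 0`.
    have hb : b = 0 := by
      have := congrArg (fun Z => form Z B) h0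
      simpa [h.incident, h.tangent, h.unit] using this
    subst hb
    have hv : v = 0 := by
      refine h.injective v (Submodule.mem_span_singleton.mpr ⟨-a, ?_⟩)
      rw [neg_smul, neg_eq_iff_add_eq_zero]
      simpa using h0
    subst hv
    have ha : a = 0 := by simpa [h.ne_zero] using h0
    simp [ha]
  have hfin : Module.finrank ℝ (LinearMap.range Θ) = n + 1 := by
    rw [LinearMap.finrank_range_of_inj hinj]
    simp [hE]
    omega
  have horth := LinearMap.BilinForm.finrank_orthogonal (formB_nondegenerate (n := n))
    (LinearMap.range Θ)
  rw [hfin] at horth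
  have hle : Submodule.span ℝ {A} ≤ (formB n).orthogonal (LinearMap.range Θ) := by
    rw [Submodule.span_singleton_le_iff_mem]
    rintro _ ⟨⟨a, v, b⟩, rfl⟩
    change form (Θ (a, v, b)) A = 0
    simp [hΘ, h.null, form_comm _ A, h.orthogonal, h.incident]
  have heq := Submodule.eq_of_le_of_finrank_eq hle (by
    rw [horth, finrank_span_singleton h.ne_zero]; simp)
  rw [heq]
  rintro _ ⟨⟨a, v, b⟩, rfl⟩
  change form (Θ (a, v, b)) X = 0
  simp [hΘ, hA, hP, hB]

/-- The tangent hyperspheres form a parabolic pencil: removing the `B`-component of `X` leaves a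
vector covered by `mem_span`. -/
theorem exists_eq_add (h : IsAdapted A P B) [FiniteDimensional ℝ E] (hn : 1 ≤ n)
    (hE : Module.finrank ℝ E = n - 1) {X : PolySpace n} (hA : form A X = 0)
    (hP : ∀ v, form (P v) X = 0) : ∃ k : ℝ, X = form B X • B + k • A := by
  have := h.mem_span hn hE (X := X - form B X • B) (by simp [hA, h.incident])
    (fun v => by simp [hP, h.tangent]) (by simp [h.unit])
  obtain ⟨k, hk⟩ := Submodule.mem_span_singleton.mp this
  exact ⟨k, by rw [hk]; abel⟩

end IsAdapted

end FormAlgebra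

/-! ### Gram matrices, multiplicities and the kernel of the second fundamental form -/

section Eigen

open Matrix

variable {ι : Type*} [Fintype ι] [DecidableEq ι]

theorem isUnit_det_of_pos {G : Matrix ι ι ℝ} (hpos : ∀ v : ι → ℝ, v ≠ 0 → 0 < v ⬝ᵥ G *ᵥ v) :
    IsUnit G.det := by
  rw [← Matrix.isUnit_iff_isUnit_det, ← Matrix.mulVec_injective_iff_isUnit]
  rw [← Matrix.coe_mulVecLin, ← LinearMap.ker_eq_bot, LinearMap.ker_eq_bot']
  intro v hv
  by_contra h
  have := hpos v h
  rw [Matrix.mulVecLin_apply] at hv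
  simp [hv] at this

/-- For the pencil of a symmetric matrix and a positive definite one, algebraic and geometric
multiplicities agree. -/
theorem rootMultiplicity_charpoly_inv_mul {G S : Matrix ι ι ℝ} (hS : Sᵀ = S) (hG : Gᵀ = G)
    (hpos : ∀ v : ι → ℝ, v ≠ 0 → 0 < v ⬝ᵥ G *ᵥ v) (a : ℝ) :
    (G⁻¹ * S).charpoly.rootMultiplicity a =
      Module.finrank ℝ (LinearMap.ker (S - a • G).mulVecLin) := by
  have hu := isUnit_det_of_pos hpos
  set T : Module.End ℝ (ι → ℝ) := Matrix.toLin' (G⁻¹ * S) with hT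
  set N := T - algebraMap ℝ (Module.End ℝ (ι → ℝ)) a with hN
  have hGN : ∀ v, G *ᵥ (N v) = (S - a • G) *ᵥ v := by
    intro v
    simp only [hN, hT, LinearMap.sub_apply, Matrix.toLin'_apply, Module.algebraMap_end_apply,
      Matrix.mulVec_sub, Matrix.mulVec_mulVec, Matrix.sub_mulVec, Matrix.mulVec_smul,
      Matrix.smul_mulVec]
    rw [← Matrix.mul_assoc, Matrix.mul_nonsing_inv _ hu, Matrix.one_mul]
  have hsymm : (S - a • G)ᵀ = S - a • G := by
    rw [Matrix.transpose_sub, Matrix.transpose_smul, hS, hG]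
  -- `N = G⁻¹ S - a` is self-adjoint for the inner product `G`. Hence `N² v = 0` gives `(N v, N v) =
  -- 0`, and generalized eigenvectors are eigenvectors.
  have hadj : ∀ v w, w ⬝ᵥ G *ᵥ (N v) = N w ⬝ᵥ G *ᵥ v := by
    intro v w
    rw [hGN, Matrix.dotProduct_mulVec, ← Matrix.mulVec_transpose, hsymm, ← hGN,
      Matrix.dotProduct_mulVec, ← Matrix.mulVec_transpose, hG]
  have hker : ∀ v, N (N v) = 0 → N v = 0 := by
    intro v hv
    by_contra h
    have := hpos _ h
    rw [hadj v (N v), hv] at this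
    simp at this
  have hmax : T.maxGenEigenspace a = T.eigenspace a := by
    refine le_antisymm ?_ (T.genEigenspace_le_maximal a 1)
    intro v hv
    obtain ⟨k, hk⟩ := (Module.End.mem_maxGenEigenspace _ _ _).mp hv
    rw [Module.End.mem_eigenspace_iff]
    have : N v = 0 := by
      induction k with
      | zero => 
        have : v = 0 := by simpa using hk
        simp [this]
      | succ k ih =>
        cases k with
        | zero => simpa [hN] using hk
        | succ k =>
          apply ih
          rw [pow_succ', pow_succ'] at hk
          rw [pow_succ']
          exact hker _ hk
    rw [hN, LinearMap.sub_apply, sub_eq_zero] at this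
    simpa using this
  have h1 := LinearMap.finrank_maxGenEigenspace_eq T a
  rw [hmax] at h1
  have h2 : T.charpoly = (G⁻¹ * S).charpoly := Matrix.charpoly_toLin' _
  rw [← h2, ← h1]
  have : T.eigenspace a = LinearMap.ker (S - a • G).mulVecLin := by
    ext v
    rw [Module.End.mem_eigenspace_iff, LinearMap.mem_ker, Matrix.mulVecLin_apply, ← hGN]
    constructor
    · intro h
      have : N v = 0 := by simp [hN, h]
      simp [this]
    · intro h
      have h3 : N v = 0 := by
        have := congrArg (G⁻¹ *ᵥ ·) h
        simpa [Matrix.mulVec_mulVec, Matrix.nonsing_inv_mul _ hu] using this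
      rw [hN, LinearMap.sub_apply, sub_eq_zero] at h3
      simpa using h3
  rw [this]

variable {n d : ℕ}

/-- The Gram matrix of two linear maps into the space of polyspherical coordinates. -/
noncomputable def gram (P Q : EuclideanSpace ℝ (Fin d) →L[ℝ] PolySpace n) :
    Matrix (Fin d) (Fin d) ℝ :=
  Matrix.of fun i j => form (P (EuclideanSpace.single i 1)) (Q (EuclideanSpace.single j 1))

theorem dotProduct_gram_mulVec (P Q : EuclideanSpace ℝ (Fin d) →L[ℝ] PolySpace n)
    (v w : EuclideanSpace ℝ (Fin d)) :
    w.ofLp ⬝ᵥ gram P Q *ᵥ v.ofLp = form (P w) (Q v) := by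
  have hv : ∀ v : EuclideanSpace ℝ (Fin d),
      v = ∑ i, v i • EuclideanSpace.single i (1 : ℝ) := fun v => by
    simpa using ((EuclideanSpace.basisFun (Fin d) ℝ).sum_repr v).symm
  conv_rhs => rw [hv v, hv w]
  simp only [← formB_apply, map_sum, map_smul, LinearMap.sum_apply, LinearMap.smul_apply,
    smul_eq_mul, dotProduct, Matrix.mulVec, gram, Matrix.of_apply]
  simp only [Finset.mul_sum]
  rw [Finset.sum_comm]
  exact Finset.sum_congr rfl fun i _ => Finset.sum_congr rfl fun j _ => by ring

theorem gram_transpose (P Q : EuclideanSpace ℝ (Fin d) →L[ℝ] PolySpace n) :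
    (gram P Q)ᵀ = gram Q P := by
  ext i j
  exact form_comm _ _

/-- The matrix of a linear endomorphism in the standard basis. -/
noncomputable def mat (D : EuclideanSpace ℝ (Fin d) →L[ℝ] EuclideanSpace ℝ (Fin d)) :
    Matrix (Fin d) (Fin d) ℝ :=
  Matrix.of fun i j => D (EuclideanSpace.single j 1) i

theorem mat_mulVec (D : EuclideanSpace ℝ (Fin d) →L[ℝ] EuclideanSpace ℝ (Fin d))
    (v : EuclideanSpace ℝ (Fin d)) : mat D *ᵥ v.ofLp = (D v).ofLp := by
  have hv : v = ∑ i, v i • EuclideanSpace.single i (1 : ℝ) := by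
    simpa using ((EuclideanSpace.basisFun (Fin d) ℝ).sum_repr v).symm
  conv_rhs => rw [hv]
  ext i
  simp [mat, Matrix.mulVec, dotProduct, mul_comm]

theorem gram_comp (P Q : EuclideanSpace ℝ (Fin d) →L[ℝ] PolySpace n)
    (D : EuclideanSpace ℝ (Fin d) →L[ℝ] EuclideanSpace ℝ (Fin d)) :
    gram (P.comp D) (Q.comp D) = (mat D)ᵀ * gram P Q * mat D := by
  ext i j
  have h1 := dotProduct_gram_mulVec (P.comp D) (Q.comp D) (EuclideanSpace.single j 1)
    (EuclideanSpace.single i 1)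
  have h2 := dotProduct_gram_mulVec P Q (D (EuclideanSpace.single j 1))
    (D (EuclideanSpace.single i 1))
  rw [ContinuousLinearMap.comp_apply, ContinuousLinearMap.comp_apply, ← h2, ← mat_mulVec,
    ← mat_mulVec, ← Matrix.vecMul_transpose (mat D) (EuclideanSpace.single i 1).ofLp,
    ← Matrix.dotProduct_mulVec, Matrix.mulVec_mulVec, Matrix.mulVec_mulVec] at h1
  simpa using h1

theorem isUnit_det_mat (D : EuclideanSpace ℝ (Fin d) ≃L[ℝ] EuclideanSpace ℝ (Fin d)) :
    IsUnit (mat (D : EuclideanSpace ℝ (Fin d) →L[ℝ] EuclideanSpace ℝ (Fin d))).det := by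
  rw [← Matrix.isUnit_iff_isUnit_det, ← Matrix.mulVec_injective_iff_isUnit,
    ← Matrix.coe_mulVecLin, ← LinearMap.ker_eq_bot, LinearMap.ker_eq_bot']
  intro v hv
  have h := mat_mulVec (D : EuclideanSpace ℝ (Fin d) →L[ℝ] EuclideanSpace ℝ (Fin d))
    (WithLp.toLp 2 v)
  rw [Matrix.mulVecLin_apply] at hv
  rw [WithLp.ofLp_toLp, hv] at h
  have h0 : D (WithLp.toLp 2 v) = 0 := by ext i; exact (congrFun h i).symm
  have h1 : WithLp.toLp 2 v = 0 := by simpa using h0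
  simpa using h1

/-- The affinor `g⁻¹ λ` of the second fundamental form `λ = -(dA, dB)`. -/
noncomputable def shape (P Q : EuclideanSpace ℝ (Fin d) →L[ℝ] PolySpace n) :
    Matrix (Fin d) (Fin d) ℝ :=
  (gram P P)⁻¹ * -gram P Q

/-- A change of coordinates conjugates the affinor. This allows the trace, defined with the
preferred chart of each point, to be computed in one fixed chart. -/
theorem trace_shape_comp (P Q : EuclideanSpace ℝ (Fin d) →L[ℝ] PolySpace n)
    (D : EuclideanSpace ℝ (Fin d) ≃L[ℝ] EuclideanSpace ℝ (Fin d)) :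
    (shape (P.comp (D : EuclideanSpace ℝ (Fin d) →L[ℝ] EuclideanSpace ℝ (Fin d)))
      (Q.comp (D : EuclideanSpace ℝ (Fin d) →L[ℝ] EuclideanSpace ℝ (Fin d)))).trace
      = (shape P Q).trace := by
  have hu := isUnit_det_mat D
  set X := mat (D : EuclideanSpace ℝ (Fin d) →L[ℝ] EuclideanSpace ℝ (Fin d)) with hX
  have hu' : IsUnit Xᵀ.det := by rwa [Matrix.det_transpose]
  rw [shape, shape, gram_comp, gram_comp, ← hX, Matrix.mul_inv_rev, Matrix.mul_inv_rev]
  have : X⁻¹ * ((gram P P)⁻¹ * Xᵀ⁻¹) * -(Xᵀ * gram P Q * X)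
      = X⁻¹ * ((gram P P)⁻¹ * (Xᵀ⁻¹ * Xᵀ) * -gram P Q * X) := by
    simp only [Matrix.mul_neg, Matrix.neg_mul, Matrix.mul_assoc]
  rw [this, Matrix.nonsing_inv_mul _ hu', Matrix.mul_one, Matrix.trace_mul_comm,
    Matrix.mul_assoc, Matrix.mul_nonsing_inv _ hu, Matrix.mul_one]

/-- The kernel of the second fundamental form `-(dA, dB)`. -/
def nullSpace (P Q : EuclideanSpace ℝ (Fin d) →L[ℝ] PolySpace n) :
    Submodule ℝ (EuclideanSpace ℝ (Fin d)) where
  carrier := {v | ∀ w, form (P w) (Q v) = 0}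
  add_mem' := fun hv hw z => by simp [hv z, hw z]
  zero_mem' := fun z => by simp
  smul_mem' := fun c v hv z => by simp [hv z]

theorem mem_nullSpace {P Q : EuclideanSpace ℝ (Fin d) →L[ℝ] PolySpace n}
    {v : EuclideanSpace ℝ (Fin d)} : v ∈ nullSpace P Q ↔ ∀ w, form (P w) (Q v) = 0 := Iff.rfl

theorem mem_nullSpace_iff_mulVec {P Q : EuclideanSpace ℝ (Fin d) →L[ℝ] PolySpace n}
    {v : EuclideanSpace ℝ (Fin d)} : v ∈ nullSpace P Q ↔ gram P Q *ᵥ v.ofLp = 0 := by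
  rw [mem_nullSpace]
  constructor
  · intro h
    rw [← dotProduct_eq_zero_iff]
    intro w
    rw [dotProduct_comm]
    exact (dotProduct_gram_mulVec P Q v (WithLp.toLp 2 w)).trans (h _)
  · intro h w
    rw [← dotProduct_gram_mulVec, h, dotProduct_zero]

theorem finrank_nullSpace (P Q : EuclideanSpace ℝ (Fin d) →L[ℝ] PolySpace n) :
    Module.finrank ℝ (nullSpace P Q) = Module.finrank ℝ (LinearMap.ker (gram P Q).mulVecLin) := by
  have : nullSpace P Q = (LinearMap.ker (gram P Q).mulVecLin).comap
      (WithLp.linearEquiv 2 ℝ (Fin d → ℝ)).toLinearMap := by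
    ext v
    rw [mem_nullSpace_iff_mulVec]
    simp
  rw [this]
  exact LinearEquiv.finrank_eq ((WithLp.linearEquiv 2 ℝ (Fin d → ℝ)).ofSubmodule' _)

theorem gram_add_smul (P Q : EuclideanSpace ℝ (Fin d) →L[ℝ] PolySpace n) (a : ℝ) :
    gram P (Q + a • P) = gram P Q + a • gram P P := by
  ext i j
  simp [gram]

theorem nullSpace_comp (P Q : EuclideanSpace ℝ (Fin d) →L[ℝ] PolySpace n)
    (D : EuclideanSpace ℝ (Fin d) ≃L[ℝ] EuclideanSpace ℝ (Fin d)) (v : EuclideanSpace ℝ (Fin d)) :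
    v ∈ nullSpace (P.comp (D : EuclideanSpace ℝ (Fin d) →L[ℝ] EuclideanSpace ℝ (Fin d)))
      (Q.comp (D : EuclideanSpace ℝ (Fin d) →L[ℝ] EuclideanSpace ℝ (Fin d))) ↔
      D v ∈ nullSpace P Q := by
  simp only [mem_nullSpace, ContinuousLinearMap.comp_apply, ContinuousLinearEquiv.coe_coe]
  exact ⟨fun h w => by simpa using h (D.symm w), fun h w => h _⟩

theorem finrank_nullSpace_comp (P Q : EuclideanSpace ℝ (Fin d) →L[ℝ] PolySpace n)
    (D : EuclideanSpace ℝ (Fin d) ≃L[ℝ] EuclideanSpace ℝ (Fin d)) :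
    Module.finrank ℝ
      (nullSpace (P.comp (D : EuclideanSpace ℝ (Fin d) →L[ℝ] EuclideanSpace ℝ (Fin d)))
        (Q.comp (D : EuclideanSpace ℝ (Fin d) →L[ℝ] EuclideanSpace ℝ (Fin d)))) =
      Module.finrank ℝ (nullSpace P Q) := by
  have : nullSpace (P.comp (D : EuclideanSpace ℝ (Fin d) →L[ℝ] EuclideanSpace ℝ (Fin d)))
        (Q.comp (D : EuclideanSpace ℝ (Fin d) →L[ℝ] EuclideanSpace ℝ (Fin d))) =
      (nullSpace P Q).comap D.toLinearEquiv.toLinearMap := by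
    ext v
    exact nullSpace_comp P Q D v
  rw [this]
  exact LinearEquiv.finrank_eq (D.toLinearEquiv.ofSubmodule' _)

section Pencil

variable {A B : PolySpace n} {P Q : EuclideanSpace ℝ (Fin d) →L[ℝ] PolySpace n}

theorem gram_pos (h : IsAdapted A P.toLinearMap B) (v : Fin d → ℝ) (hv : v ≠ 0) :
    0 < v ⬝ᵥ gram P P *ᵥ v := by
  have := dotProduct_gram_mulVec P P (WithLp.toLp 2 v) (WithLp.toLp 2 v)
  rw [WithLp.ofLp_toLp] at this
  rw [this]
  exact h.pos (by simpa using hv)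

/-- Multiplicity of an eigenvalue of `λ - t g` relative to `g`. -/
theorem rootMultiplicity_pencil (h : IsAdapted A P.toLinearMap B)
    (hsymm : gram Q P = gram P Q) (t a : ℝ) :
    ((gram P P)⁻¹ * (-gram P Q - t • gram P P)).charpoly.rootMultiplicity a =
      Module.finrank ℝ (nullSpace P (Q + (a + t) • P)) := by
  rw [rootMultiplicity_charpoly_inv_mul _ (gram_transpose P P) (gram_pos h), finrank_nullSpace,
    gram_add_smul]
  · have : -gram P Q - t • gram P P - a • gram P P = -(gram P Q + (a + t) • gram P P) := by
      rw [add_smul]; abel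
    have hker : LinearMap.ker (-(gram P Q + (a + t) • gram P P)).mulVecLin
        = LinearMap.ker (gram P Q + (a + t) • gram P P).mulVecLin := by
      ext v
      simp only [LinearMap.mem_ker, Matrix.mulVecLin_apply, Matrix.neg_mulVec, neg_eq_zero]
    rw [this, hker]
  · rw [Matrix.transpose_sub, Matrix.transpose_neg, Matrix.transpose_smul, gram_transpose,
      gram_transpose, hsymm]

/-- Multiplication by the invertible matrix `g` turns the eigenvector equation into the vanishing of
`λ - (a + t) g` on `v`, which is the second fundamental form of the shifted hypersphere. -/
theorem mulVec_pencil_iff (h : IsAdapted A P.toLinearMap B) (t a : ℝ)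
    (v : EuclideanSpace ℝ (Fin d)) :
    ((gram P P)⁻¹ * (-gram P Q - t • gram P P)) *ᵥ v.ofLp = a • v.ofLp ↔
      v ∈ nullSpace P (Q + (a + t) • P) := by
  have hu := isUnit_det_of_pos (gram_pos h)
  rw [mem_nullSpace_iff_mulVec, gram_add_smul]
  have key : gram P P *ᵥ (((gram P P)⁻¹ * (-gram P Q - t • gram P P)) *ᵥ v.ofLp - a • v.ofLp)
      = -((gram P Q + (a + t) • gram P P) *ᵥ v.ofLp) := by
    rw [Matrix.mulVec_sub, Matrix.mulVec_mulVec, ← Matrix.mul_assoc,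
      Matrix.mul_nonsing_inv _ hu, Matrix.one_mul, Matrix.mulVec_smul, Matrix.sub_mulVec,
      Matrix.add_mulVec, Matrix.neg_mulVec, Matrix.smul_mulVec, Matrix.smul_mulVec, add_smul]
    abel
  rw [← sub_eq_zero]
  constructor
  · intro h0
    rw [h0, Matrix.mulVec_zero] at key
    simpa using key.symm
  · intro h0
    rw [h0, neg_zero] at key
    have := congrArg ((gram P P)⁻¹ *ᵥ ·) key
    simpa [Matrix.mulVec_mulVec, Matrix.nonsing_inv_mul _ hu] using this

end Pencil

end Eigen

/-! ### Linear maps of constant rank and the constant rank theorem -/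

section ConstantRank

open Topology Filter

variable {E F G X : Type*} [NormedAddCommGroup E] [NormedSpace ℝ E]
  [NormedAddCommGroup F] [NormedSpace ℝ F] [NormedAddCommGroup G] [NormedSpace ℝ G]

/-- A linear map of rank `r` factors the identity of `ℝ^r`. -/
theorem exists_factor_id [FiniteDimensional ℝ E] [FiniteDimensional ℝ G]
    {m r : ℕ} (hE : Module.finrank ℝ E = m + r) (N : E →L[ℝ] G)
    (hN : Module.finrank ℝ (LinearMap.ker N.toLinearMap) = m) :
    ∃ (R : G →L[ℝ] EuclideanSpace ℝ (Fin r)) (J : EuclideanSpace ℝ (Fin r) →L[ℝ] E),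
      ∀ t, R (N (J t)) = t := by
  have hr : Module.finrank ℝ (LinearMap.range N.toLinearMap) = r := by
    have := LinearMap.finrank_range_add_finrank_ker N.toLinearMap
    omega
  let i : LinearMap.range N.toLinearMap ≃ₗ[ℝ] EuclideanSpace ℝ (Fin r) :=
    LinearEquiv.ofFinrankEq _ _ (by simp [hr])
  obtain ⟨π, hπ⟩ := LinearMap.exists_leftInverse_of_injective
    (LinearMap.range N.toLinearMap).subtype (Submodule.ker_subtype _)
  let R : G →ₗ[ℝ] EuclideanSpace ℝ (Fin r) := i.toLinearMap ∘ₗ π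
  have hR : ∀ v, R (N v) = i (N.toLinearMap.rangeRestrict v) := fun v => by
    have := LinearMap.congr_fun hπ (N.toLinearMap.rangeRestrict v)
    exact congrArg i this
  obtain ⟨J, hJ⟩ := LinearMap.exists_rightInverse_of_surjective
    (i.toLinearMap ∘ₗ N.toLinearMap.rangeRestrict)
    (LinearMap.range_eq_top.mpr (i.surjective.comp N.toLinearMap.surjective_rangeRestrict))
  refine ⟨LinearMap.toContinuousLinearMap R, LinearMap.toContinuousLinearMap J, fun t => ?_⟩
  exact (hR _).trans (LinearMap.congr_fun hJ t)

/-- When `R ∘ N` is onto `ℝ^r`, its kernel has dimension `m`, so it cannot be larger than the kernel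
of `N` inside it. -/
theorem apply_eq_zero_of_comp_eq_zero [FiniteDimensional ℝ E] {m r : ℕ}
    (hE : Module.finrank ℝ E = m + r)
    {N : E →L[ℝ] G} (hN : Module.finrank ℝ (LinearMap.ker N.toLinearMap) = m)
    {R : G →L[ℝ] EuclideanSpace ℝ (Fin r)} (hR : Function.Surjective (R.comp N)) {v : E}
    (hv : R (N v) = 0) : N v = 0 := by
  have h1 := LinearMap.finrank_range_add_finrank_ker (R.comp N).toLinearMap
  rw [LinearMap.range_eq_top.mpr hR, finrank_top, finrank_euclideanSpace_fin] at h1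
  have hle : LinearMap.ker N.toLinearMap ≤ LinearMap.ker (R.comp N).toLinearMap := by
    intro w hw
    have hw' : N w = 0 := hw
    simp [hw']
  have := Submodule.eq_of_le_of_finrank_eq hle (by omega)
  have hv' : v ∈ LinearMap.ker (R.comp N).toLinearMap := hv
  rw [← this] at hv'
  exact hv'

theorem surjective_of_isUnit_comp {r : ℕ} {N : E →L[ℝ] G} {R : G →L[ℝ] EuclideanSpace ℝ (Fin r)}
    {J : EuclideanSpace ℝ (Fin r) →L[ℝ] E} (h : IsUnit (R.comp (N.comp J))) :
    Function.Surjective (R.comp N) := by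
  obtain ⟨S, hS⟩ := h.exists_right_inv
  intro t
  exact ⟨J (S t), congrArg (fun f => f t) hS⟩

theorem eventually_isUnit_of_eq_one [CompleteSpace E] [TopologicalSpace X]
    {f : X → E →L[ℝ] E} {x : X} (hf : ContinuousAt f x)
    (h1 : f x = 1) : ∀ᶠ y in 𝓝 x, IsUnit (f y) := by
  have : {a : E →L[ℝ] E | IsUnit a} ∈ 𝓝 (f x) :=
    Units.isOpen.mem_nhds (by rw [h1]; exact isUnit_one)
  exact hf this

/-- A vector in the kernel of a member of a family of linear maps of constant rank extends to a
differentiable field of vectors in the kernels. -/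
theorem exists_differentiableAt_section [FiniteDimensional ℝ E] [FiniteDimensional ℝ G]
    [NormedAddCommGroup X] [NormedSpace ℝ X] {m r : ℕ} (hE : Module.finrank ℝ E = m + r)
    {N : X → E →L[ℝ] G} {x : X} (hd : DifferentiableAt ℝ N x)
    (hN : ∀ᶠ y in 𝓝 x, Module.finrank ℝ (LinearMap.ker (N y).toLinearMap) = m) {v : E}
    (hv : N x v = 0) :
    ∃ V : X → E, DifferentiableAt ℝ V x ∧ V x = v ∧ ∀ᶠ y in 𝓝 x, N y (V y) = 0 := by
  obtain ⟨R, J, hRJ⟩ := exists_factor_id hE (N x) hN.self_of_nhds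
  let M : X → EuclideanSpace ℝ (Fin r) →L[ℝ] EuclideanSpace ℝ (Fin r) :=
    fun y => R.comp ((N y).comp J)
  have hM : DifferentiableAt ℝ M x := by
    refine (differentiableAt_const R).clm_comp (hd.clm_comp (differentiableAt_const J))
  have hM1 : M x = 1 := by ext1 t; exact hRJ t
  have hinv : DifferentiableAt ℝ (fun y => Ring.inverse (M y)) x := by
    have h : DifferentiableAt ℝ Ring.inverse (M x) :=
      differentiableAt_inverse (𝕜 := ℝ) (by rw [hM1]; exact isUnit_one)
    exact h.comp x hM
  -- The correction is chosen so that `R (N y (V y)) = 0`; by constancy of the rank this already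
  -- forces `N y (V y) = 0`.
  refine ⟨fun y => v - J (Ring.inverse (M y) (R (N y v))), ?_, by simp [hv], ?_⟩
  · refine (differentiableAt_const v).sub (J.differentiableAt.comp x (hinv.clm_apply ?_))
    exact R.differentiableAt.comp x (hd.clm_apply (differentiableAt_const v))
  · filter_upwards [hN, eventually_isUnit_of_eq_one hM.continuousAt hM1] with y hy hu
    refine apply_eq_zero_of_comp_eq_zero hE hy (surjective_of_isUnit_comp hu) ?_
    have := congrArg (fun f => f (R (N y v))) (Ring.mul_inverse_cancel (M y) hu)
    have h2 : R (N y (J (Ring.inverse (M y) (R (N y v))))) = R (N y v) := this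
    rw [map_sub, map_sub, h2, sub_self]

/-- The derivative of a family of symmetric bilinear forms of constant rank vanishes on the
kernel. -/
theorem deriv_symm_apply_ker [FiniteDimensional ℝ E] {m r : ℕ} (hE : Module.finrank ℝ E = m + r)
    {N : E → E →L[ℝ] E →L[ℝ] ℝ} {x : E} {N' : E →L[ℝ] E →L[ℝ] E →L[ℝ] ℝ}
    (hd : HasFDerivAt N N' x)
    (hN : ∀ᶠ y in 𝓝 x, Module.finrank ℝ (LinearMap.ker (N y).toLinearMap) = m)
    (hsymm : ∀ v w, N x v w = N x w v) {v z : E} (hv : N x v = 0) (hz : N x z = 0) (w : E) :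
    N' w v z = 0 := by
  obtain ⟨V, hV, hVx, hV0⟩ := exists_differentiableAt_section hE hd.differentiableAt hN hv
  -- Differentiating `N y (V y) = 0` and evaluating on `z` gives `N' w v z + N x (V' w) z = 0`. By
  -- symmetry the second term is `N x z (V' w)`, which vanishes.
  have h1 := hd.clm_apply hV.hasFDerivAt
  have h2 : HasFDerivAt (fun y => N y (V y)) (0 : E →L[ℝ] E →L[ℝ] ℝ) x :=
    (hasFDerivAt_const (0 : E →L[ℝ] ℝ) x).congr_of_eventuallyEq hV0
  have h3 := congrArg (fun f => f w z) (h1.unique h2)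
  simp only [add_apply, ContinuousLinearMap.comp_apply,
    ContinuousLinearMap.flip_apply, hVx, zero_apply] at h3
  rw [hsymm, hz] at h3
  simpa using h3

/-- The segment from `z` to `z'` stays in `s` and has its direction in `ker q`, so `g` has zero
derivative along it. -/
theorem eq_of_fderiv_eq_zero_on_ker {g : E → F} {q : E →L[ℝ] G} {s : Set E} (hs : Convex ℝ s)
    (hg : ∀ z ∈ s, DifferentiableAt ℝ g z) (h0 : ∀ z ∈ s, ∀ w, q w = 0 → fderiv ℝ g z w = 0)
    {z z' : E} (hz : z ∈ s) (hz' : z' ∈ s) (hq : q z = q z') : g z = g z' := by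
  let c : ℝ → E := fun t => z + t • (z' - z)
  have hc : ∀ t ∈ Set.Icc (0 : ℝ) 1, c t ∈ s := fun t ht =>
    hs.add_smul_sub_mem hz hz' ht
  have hd : ∀ t ∈ Set.Icc (0 : ℝ) 1, HasDerivAt (g ∘ c) 0 t := by
    intro t ht
    have h1 : HasDerivAt c (z' - z) t := by
      have := ((hasDerivAt_id t).smul_const (z' - z)).const_add z
      rwa [one_smul] at this
    have h2 := (hg _ (hc t ht)).hasFDerivAt.comp_hasDerivAt t h1
    rwa [h0 _ (hc t ht) _ (by rw [map_sub, hq, sub_self])] at h2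
  have := constant_of_has_deriv_right_zero (f := g ∘ c)
    (fun t ht => (hd t ht).continuousAt.continuousWithinAt)
    (fun t ht => (hd t ⟨ht.1, ht.2.le⟩).hasDerivWithinAt) 1 ⟨zero_le_one, le_rfl⟩
  simpa [c] using this.symm

/-- The constant rank theorem: locally, a map of constant rank is an immersion following a
submersion. -/
theorem exists_eq_immersion_comp_submersion [FiniteDimensional ℝ E]
    [FiniteDimensional ℝ F] {m r : ℕ} (hE : Module.finrank ℝ E = m + r)
    {Ω : Set E} (hΩ : IsOpen Ω) {B : E → F} (hB : ContDiffOn ℝ ∞ B Ω)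
    (hker : ∀ y ∈ Ω, Module.finrank ℝ (LinearMap.ker (fderiv ℝ B y).toLinearMap) = m)
    {y₀ : E} (hy₀ : y₀ ∈ Ω) :
    ∃ (U : Set (EuclideanSpace ℝ (Fin r))) (b : EuclideanSpace ℝ (Fin r) → F)
      (u : E → EuclideanSpace ℝ (Fin r)) (Ω' : Set E),
      IsOpen U ∧ ContDiffOn ℝ ∞ b U ∧ (∀ t ∈ U, Function.Injective (fderiv ℝ b t)) ∧
      (∀ t ∈ U, ∃ y ∈ Ω, b t = B y) ∧
      IsOpen Ω' ∧ y₀ ∈ Ω' ∧ Ω' ⊆ Ω ∧ ContDiffOn ℝ ∞ u Ω' ∧ Set.MapsTo u Ω' U ∧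
      (∀ y ∈ Ω', Function.Surjective (fderiv ℝ u y)) ∧ ∀ y ∈ Ω', B y = b (u y) := by
  have hBat : ∀ y ∈ Ω, ContDiffAt ℝ ∞ B y := fun y hy => hB.contDiffAt (hΩ.mem_nhds hy)
  have hBd : ∀ y ∈ Ω, HasFDerivAt B (fderiv ℝ B y) y := fun y hy =>
    ((hBat y hy).differentiableAt (by simp)).hasFDerivAt
  have hBc : ContinuousAt (fderiv ℝ B) y₀ :=
    ((hBat y₀ hy₀).fderiv_right (m := 0) (by simp)).continuousAt
  obtain ⟨R, J, hRJ⟩ := exists_factor_id hE (fderiv ℝ B y₀) (hker y₀ hy₀)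
  set q : E →L[ℝ] EuclideanSpace ℝ (Fin r) := R.comp (fderiv ℝ B y₀) with hq
  have hqJ : ∀ t, q (J t) = t := hRJ
  set u : E → EuclideanSpace ℝ (Fin r) := fun y => R (B y) with hu
  -- `Φ` straightens `u`: it has derivative `1` at `y₀` and satisfies `q ∘ Φ = u`, so in the new
  -- coordinates `u` becomes the linear map `q`.
  set Φ : E → E := fun y => J (u y) + (y - J (q y)) with hΦ
  have hqΦ : ∀ y, q (Φ y) = u y := fun y => by simp [hΦ, hqJ]
  have hud : ∀ y ∈ Ω, HasFDerivAt u (R.comp (fderiv ℝ B y)) y := fun y hy =>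
    R.hasFDerivAt.comp y (hBd y hy)
  have huat : ∀ y ∈ Ω, ContDiffAt ℝ ∞ u y := fun y hy => R.contDiff.contDiffAt.comp y (hBat y hy)
  let Φ' : E → E →L[ℝ] E := fun y =>
    J.comp (R.comp (fderiv ℝ B y)) + (ContinuousLinearMap.id ℝ E - J.comp q)
  have hΦd : ∀ y ∈ Ω, HasFDerivAt Φ (Φ' y) y := fun y hy =>
    (J.hasFDerivAt.comp y (hud y hy)).add ((hasFDerivAt_id y).sub (J.comp q).hasFDerivAt)
  have hΦat : ∀ y ∈ Ω, ContDiffAt ℝ ∞ Φ y := fun y hy =>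
    (J.contDiff.contDiffAt.comp y (huat y hy)).add
      (contDiffAt_id.sub (J.comp q).contDiff.contDiffAt)
  have hΦ'1 : Φ' y₀ = 1 := by
    ext v
    simp [Φ', hq]
  have hΦ'c : ContinuousAt Φ' y₀ :=
    (continuousAt_const.clm_comp (continuousAt_const.clm_comp hBc)).add continuousAt_const
  let M : E → EuclideanSpace ℝ (Fin r) →L[ℝ] EuclideanSpace ℝ (Fin r) :=
    fun y => R.comp ((fderiv ℝ B y).comp J)
  have hM1 : M y₀ = 1 := by ext1 t; exact hRJ t
  have hMc : ContinuousAt M y₀ :=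
    continuousAt_const.clm_comp (hBc.clm_comp continuousAt_const)
  have hd₀ : HasFDerivAt Φ ((ContinuousLinearEquiv.refl ℝ E : E ≃L[ℝ] E) : E →L[ℝ] E) y₀ := by
    have := hΦd y₀ hy₀
    rwa [hΦ'1] at this
  let e := (hΦat y₀ hy₀).toOpenPartialHomeomorph Φ hd₀ (by simp)
  have hesrc : y₀ ∈ e.source := (hΦat y₀ hy₀).mem_toOpenPartialHomeomorph_source hd₀ (by simp)
  have heΦ : ∀ y, e y = Φ y := fun y => rfl
  have hev : ∀ᶠ y in 𝓝 y₀, y ∈ Ω ∧ IsUnit (Φ' y) ∧ IsUnit (M y) :=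
    (hΩ.eventually_mem hy₀).and ((eventually_isUnit_of_eq_one hΦ'c hΦ'1).and
      (by
        have : {a : EuclideanSpace ℝ (Fin r) →L[ℝ] EuclideanSpace ℝ (Fin r) | IsUnit a}
            ∈ 𝓝 (M y₀) := Units.isOpen.mem_nhds (by rw [hM1]; exact isUnit_one)
        exact hMc this))
  obtain ⟨Ω₁, hΩ₁, hΩ₁o, hy₁⟩ := eventually_nhds_iff.mp hev
  have hz₀ : Φ y₀ ∈ e.target := e.map_source hesrc
  have hpre : e.target ∩ e.symm ⁻¹' Ω₁ ∈ 𝓝 (Φ y₀) := by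
    refine (e.isOpen_inter_preimage_symm hΩ₁o).mem_nhds ⟨hz₀, ?_⟩
    change e.symm (e y₀) ∈ Ω₁
    rwa [e.left_inv hesrc]
  obtain ⟨ε, hε, hball⟩ := Metric.mem_nhds_iff.mp hpre
  have hsymm : ∀ z ∈ Metric.ball (Φ y₀) ε, ContDiffAt ℝ ∞ e.symm z := by
    intro z hz
    obtain ⟨hzt, hz1⟩ := hball hz
    obtain ⟨h1, ⟨w, hw⟩, -⟩ := hΩ₁ _ hz1
    refine e.contDiffAt_symm (f₀' := ContinuousLinearEquiv.ofUnit w) hzt ?_ (hΦat _ h1)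
    have := hΦd _ h1
    rw [← hw] at this
    exact this
  have hgat : ∀ z ∈ Metric.ball (Φ y₀) ε, ContDiffAt ℝ ∞ (B ∘ e.symm) z := fun z hz =>
    (hBat _ (hΩ₁ _ (hball hz).2).1).comp z (hsymm z hz)
  have huq : ∀ z ∈ Metric.ball (Φ y₀) ε, u (e.symm z) = q z := fun z hz => by
    rw [← hqΦ, ← heΦ, e.right_inv (hball hz).1]
  -- In the straightened coordinates `B` factors through `q`: a direction killed by `q = d(u ∘
  -- e.symm)` is killed by `R ∘ dB`, and therefore, the rank being constant, by `dB`.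
  have hconst : ∀ z ∈ Metric.ball (Φ y₀) ε, ∀ z' ∈ Metric.ball (Φ y₀) ε, q z = q z' →
      (B ∘ e.symm) z = (B ∘ e.symm) z' := by
    intro z hz z' hz' hzz
    refine eq_of_fderiv_eq_zero_on_ker (convex_ball _ _)
      (fun y hy => (hgat y hy).differentiableAt (by simp)) (fun y hy w hw => ?_) hz hz' hzz
    obtain ⟨h1, -, h3⟩ := hΩ₁ _ (hball hy).2
    have hs := ((hsymm y hy).differentiableAt (by simp)).hasFDerivAt
    rw [((hBd _ h1).comp y hs).fderiv]
    refine apply_eq_zero_of_comp_eq_zero hE (hker _ h1) (surjective_of_isUnit_comp h3) ?_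
    have h4 := (hud _ h1).comp y hs
    have h5 : HasFDerivAt (u ∘ e.symm) q y := by
      refine q.hasFDerivAt.congr_of_eventuallyEq ?_
      filter_upwards [Metric.isOpen_ball.mem_nhds hy] with z hz using huq z hz
    have h6 := congrArg (fun f => f w) (h4.unique h5)
    exact h6.trans hw
  -- An affine section of `q` through `Φ y₀`; restricting `B ∘ e.symm` to it gives `b`.
  let σ : EuclideanSpace ℝ (Fin r) → E := fun t => Φ y₀ + J (t - u y₀)
  have hσ : ContDiff ℝ ∞ σ := contDiff_const.add (J.contDiff.comp (contDiff_id.sub contDiff_const))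
  have hqσ : ∀ t, q (σ t) = t := fun t => by simp [σ, hqJ, hqΦ]
  have hbat : ∀ t ∈ σ ⁻¹' Metric.ball (Φ y₀) ε, ContDiffAt ℝ ∞ (fun t => B (e.symm (σ t))) t :=
    fun t ht => (hgat _ ht).comp t hσ.contDiffAt
  have hUo : IsOpen (σ ⁻¹' Metric.ball (Φ y₀) ε) := Metric.isOpen_ball.preimage hσ.continuous
  have hΦc : ContinuousOn Φ Ω := fun y hy => (hΦd y hy).continuousAt.continuousWithinAt
  have huc : ContinuousOn u Ω := fun y hy => (hud y hy).continuousAt.continuousWithinAt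
  have hsub : Ω₁ ⊆ Ω := fun y hy => (hΩ₁ y hy).1
  -- On the chosen neighbourhood both `Φ y` and `σ (u y)` lie in the ball, as `hconst` requires.
  refine ⟨σ ⁻¹' Metric.ball (Φ y₀) ε, fun t => B (e.symm (σ t)), u,
    ((Ω₁ ∩ e.source) ∩ Φ ⁻¹' Metric.ball (Φ y₀) ε) ∩
      ((Ω₁ ∩ e.source) ∩ u ⁻¹' (σ ⁻¹' Metric.ball (Φ y₀) ε)), hUo,
    fun t ht => (hbat t ht).contDiffWithinAt, fun t ht => ?_,
    fun t ht => ⟨_, hsub (hball ht).2, rfl⟩, ?_, ?_, ?_, ?_, ?_, ?_, ?_⟩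
  · have h1 := ((hbat t ht).differentiableAt (by simp)).hasFDerivAt
    -- Since `R ∘ b` is the identity on `U`, `b` is an immersion.
    have h2 : HasFDerivAt (fun t => R (B (e.symm (σ t))))
        (ContinuousLinearMap.id ℝ (EuclideanSpace ℝ (Fin r))) t := by
      refine (hasFDerivAt_id t).congr_of_eventuallyEq ?_
      filter_upwards [hUo.mem_nhds ht] with s hs
      exact (huq _ hs).trans (hqσ s)
    have h3 := (R.hasFDerivAt.comp t h1).unique h2
    intro v w hvw
    have hv := congrArg (fun f => f v) h3
    have hw := congrArg (fun f => f w) h3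
    simp only [ContinuousLinearMap.comp_apply, ContinuousLinearMap.id_apply] at hv hw
    rw [← hv, ← hw, hvw]
  · have ho := hΩ₁o.inter e.open_source
    exact ((hΦc.mono (Set.inter_subset_left.trans hsub)).isOpen_inter_preimage ho
      Metric.isOpen_ball).inter
      ((huc.mono (Set.inter_subset_left.trans hsub)).isOpen_inter_preimage ho hUo)
  · refine ⟨⟨⟨hy₁, hesrc⟩, Metric.mem_ball_self hε⟩, ⟨hy₁, hesrc⟩, ?_⟩
    simpa [σ] using hε
  · exact fun y hy => hsub hy.1.1.1
  · exact fun y hy => (huat y (hsub hy.1.1.1)).contDiffWithinAt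
  · exact fun y hy => hy.2.2
  · intro y hy
    rw [(hud y (hsub hy.1.1.1)).fderiv]
    exact surjective_of_isUnit_comp (hΩ₁ y hy.1.1.1).2.2
  · intro y hy
    have h1 := hconst (Φ y) hy.1.2 (σ (u y)) hy.2.2 (by rw [hqΦ, hqσ])
    have h2 : e.symm (Φ y) = y := e.left_inv hy.1.1.2
    simpa [h2] using h1

end ConstantRank

/-! ### Smoothness of an eigenvalue of constant multiplicity -/

section Eigenvalue

open Topology Filter

variable {E : Type*} [NormedAddCommGroup E] [NormedSpace ℝ E]
  {ι : Type*} [Fintype ι] [DecidableEq ι]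

theorem contDiffAt_mvPolynomial_eval {σ : Type*} (p : MvPolynomial σ ℝ) {f : E → σ → ℝ} {x : E}
    (hf : ∀ i, ContDiffAt ℝ ∞ (fun y => f y i) x) :
    ContDiffAt ℝ ∞ (fun y => MvPolynomial.eval (f y) p) x := by
  induction p using MvPolynomial.induction_on with
  | C a => simpa using contDiffAt_const
  | add p q hp hq => simpa using hp.add hq
  | mul_X p i hp => simpa using hp.mul (hf i)

theorem contDiffAt_charpoly_coeff {T : E → Matrix ι ι ℝ} {x : E}
    (hT : ∀ i j, ContDiffAt ℝ ∞ (fun y => T y i j) x) (k : ℕ) :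
    ContDiffAt ℝ ∞ (fun y => (T y).charpoly.coeff k) x := by
  have : ∀ y, (T y).charpoly.coeff k =
      MvPolynomial.eval (fun ij : ι × ι => T y ij.1 ij.2)
        ((Matrix.charpoly.univ ℝ ι).coeff k) := fun y => by
    have h1 := Matrix.charpoly.univ_coeff_eval₂Hom ι (RingHom.id ℝ)
      (fun ij : ι × ι => T y ij.1 ij.2) k
    have h2 : Matrix.of (Function.curry fun ij : ι × ι => T y ij.1 ij.2) = T y := rfl
    rw [h2] at h1
    exact h1.symm
  simp only [this]
  exact contDiffAt_mvPolynomial_eval _ fun ij => hT ij.1 ij.2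

/-- A continuous eigenvalue of constant multiplicity of a smooth family of matrices is smooth. -/
theorem contDiffAt_eigenvalue [CompleteSpace E] {T : E → Matrix ι ι ℝ} {x : E} {μ : E → ℝ} {m : ℕ}
    (hm : 1 ≤ m)
    (hT : ∀ i j, ContDiffAt ℝ ∞ (fun y => T y i j) x) (hμ : ContinuousAt μ x)
    (hmult : ∀ᶠ y in 𝓝 x, (T y).charpoly.rootMultiplicity (μ y) = m) :
    ContDiffAt ℝ ∞ μ x := by
  -- A root of multiplicity exactly `m` of the characteristic polynomial is a simple root of its
  -- derivative of order `m - 1`, to which the implicit function theorem applies.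
  let p : E → Polynomial ℝ := fun y => Polynomial.derivative^[m - 1] (T y).charpoly
  have hdeg : ∀ y, (p y).natDegree < Fintype.card ι + 1 := fun y => by
    have h1 : (p y).natDegree ≤ (T y).charpoly.natDegree - (m - 1) :=
      Polynomial.natDegree_iterate_derivative (T y).charpoly (m - 1)
    have h2 := (T y).charpoly_natDegree_eq_dim
    omega
  let f : E × ℝ → ℝ := fun z => (p z.1).eval z.2
  have hf : ContDiffAt ℝ ∞ f (x, μ x) := by
    have : f = fun z : E × ℝ => ∑ k ∈ Finset.range (Fintype.card ι + 1),
        ((k + (m - 1)).descFactorial (m - 1) • (T z.1).charpoly.coeff (k + (m - 1))) * z.2 ^ k := by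
      funext z
      simp only [f]
      rw [Polynomial.eval_eq_sum_range' (hdeg z.1)]
      simp only [p, Polynomial.coeff_iterate_derivative]
    rw [this]
    refine ContDiffAt.sum fun k _ => ContDiffAt.mul ?_ (contDiffAt_snd.pow k)
    refine ContDiffAt.const_smul _ ?_
    exact ContDiffAt.comp (x, μ x) (contDiffAt_charpoly_coeff hT _) contDiffAt_fst
  have hroot : ∀ᶠ y in 𝓝 x, f (y, μ y) = 0 := by
    filter_upwards [hmult] with y hy
    exact Polynomial.isRoot_iterate_derivative_of_lt_rootMultiplicity (by dsimp only; omega)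
  have hne : (Polynomial.derivative (p x)).eval (μ x) ≠ 0 := by
    have h1 := hmult.self_of_nhds
    have h2 : Polynomial.derivative (p x) = Polynomial.derivative^[m] (T x).charpoly := by
      obtain ⟨k, rfl⟩ : ∃ k, m = k + 1 := ⟨m - 1, by omega⟩
      simp only [p, Nat.add_sub_cancel, Function.iterate_succ_apply']
    intro h0
    rw [h2] at h0
    have hp0 : (T x).charpoly ≠ 0 := (Matrix.charpoly_monic _).ne_zero
    have := (Polynomial.lt_rootMultiplicity_iff_isRoot_iterate_derivative
      (n := m) hp0 (t := μ x)).mpr ?_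
    · omega
    · intro k hk
      rcases hk.lt_or_eq with hk | rfl
      · exact Polynomial.isRoot_iterate_derivative_of_lt_rootMultiplicity (by omega)
      · exact h0
  have hinr : fderiv ℝ f (x, μ x) ∘L .inr ℝ E ℝ =
      ContinuousLinearMap.toSpanSingleton ℝ ((Polynomial.derivative (p x)).eval (μ x)) := by
    have h1 : HasFDerivAt (fun s : ℝ => ((x, s) : E × ℝ)) (.inr ℝ E ℝ) (μ x) :=
      hasFDerivAt_prodMk_right x (μ x)
    have h2 := (hf.differentiableAt (by simp)).hasFDerivAt.comp (μ x) h1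
    have h3 := ((p x).hasDerivAt (μ x)).hasFDerivAt
    exact h2.unique h3
  have hinv : (fderiv ℝ f (x, μ x) ∘L .inr ℝ E ℝ).IsInvertible := by
    rw [hinr]
    exact ⟨ContinuousLinearEquiv.unitsEquivAut ℝ (Units.mk0 _ hne), by ext; simp⟩
  have hψ := hf.contDiffAt_implicitFunction (by simp) hinv
  refine hψ.congr_of_eventuallyEq ?_
  -- Continuity keeps `(y, μ y)` in the region where the implicit function is the only solution, so
  -- `μ` coincides with it.
  have hcont : Tendsto (fun y => (y, μ y)) (𝓝 x) (𝓝 (x, μ x)) :=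
    (continuousAt_id.prodMk hμ)
  filter_upwards [hcont.eventually (hf.eventually_apply_eq_iff_implicitFunction (by simp) hinv),
    hroot] with y hy hr
  have := hy.mp (hr.trans hroot.self_of_nhds.symm)
  exact this.symm

end Eigenvalue

/-! ### Frames in local coordinates: the differential geometry of the proof -/

section CoordFrame

open Topology Filter

variable {n : ℕ}

theorem form_deriv_eq {X : Type*} [NormedAddCommGroup X] [NormedSpace ℝ X]
    {f g : X → PolySpace n} {f' g' : X →L[ℝ] PolySpace n} {x : X} (hf : HasFDerivAt f f' x)
    (hg : HasFDerivAt g g' x) {k : X → ℝ} {k' : X →L[ℝ] ℝ} (hk : HasFDerivAt k k' x)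
    (h : ∀ᶠ y in 𝓝 x, form (f y) (g y) = k y) (v : X) :
    form (f' v) (g x) + form (f x) (g' v) = k' v := by
  have h1 := (formL n).hasFDerivAt_of_bilinear hf hg
  have h2 : HasFDerivAt (fun y => formL n (f y) (g y)) k' x := hk.congr_of_eventuallyEq h
  have h3 : form (f x) (g' v) + form (f' v) (g x) = k' v := congrArg (fun l => l v) (h1.unique h2)
  linarith

theorem form_deriv_add {X : Type*} [NormedAddCommGroup X] [NormedSpace ℝ X]
    {f g : X → PolySpace n} {f' g' : X →L[ℝ] PolySpace n} {x : X} (hf : HasFDerivAt f f' x)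
    (hg : HasFDerivAt g g' x) {c : ℝ} (h : ∀ᶠ y in 𝓝 x, form (f y) (g y) = c) (v : X) :
    form (f' v) (g x) + form (f x) (g' v) = 0 :=
  form_deriv_eq hf hg (hasFDerivAt_const c x) h v

/-- The factor of proportionality of two differentiable fields of vectors is differentiable. -/
theorem exists_differentiableAt_smul {X F : Type*} [NormedAddCommGroup X] [NormedSpace ℝ X]
    [NormedAddCommGroup F] [InnerProductSpace ℝ F] {A Y : X → F} {x : X}
    (hA : DifferentiableAt ℝ A x) (hY : DifferentiableAt ℝ Y x) (hA0 : A x ≠ 0)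
    (h : ∀ᶠ y in 𝓝 x, ∃ c : ℝ, Y y = c • A y) :
    ∃ f : X → ℝ, DifferentiableAt ℝ f x ∧ ∀ᶠ y in 𝓝 x, Y y = f y • A y := by
  refine ⟨fun y => inner ℝ (A y) (Y y) / inner ℝ (A y) (A y), ?_, ?_⟩
  · have h1 : DifferentiableAt ℝ (fun y => inner ℝ (A y) (Y y)) x := hA.inner ℝ hY
    have h2 : DifferentiableAt ℝ (fun y => inner ℝ (A y) (A y)) x := hA.inner ℝ hA
    have h3 : inner ℝ (A x) (A x) ≠ 0 := inner_self_ne_zero.mpr hA0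
    simp only [div_eq_mul_inv]
    exact h1.fun_mul (h2.fun_inv h3)
  · filter_upwards [h, hA.continuousAt.eventually_ne hA0] with y ⟨c, hc⟩ hy
    rw [hc, inner_smul_right, mul_div_cancel_right₀ _ (inner_self_ne_zero.mpr hy)]

/-- The product rule for `Y = f A`, used to compare two choices of homogeneous coordinates of the
same point or hypersphere. -/
theorem exists_fderiv_eq_smul_add {X F : Type*} [NormedAddCommGroup X] [NormedSpace ℝ X]
    [NormedAddCommGroup F] [InnerProductSpace ℝ F] {A Y : X → F} {x : X}
    (hA : DifferentiableAt ℝ A x) (hY : DifferentiableAt ℝ Y x) (hA0 : A x ≠ 0) (hY0 : Y x ≠ 0)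
    (h : ∀ᶠ y in 𝓝 x, ∃ c : ℝ, Y y = c • A y) :
    ∃ (f : ℝ) (f' : X →L[ℝ] ℝ), f ≠ 0 ∧ Y x = f • A x ∧
      ∀ v, fderiv ℝ Y x v = f • fderiv ℝ A x v + f' v • A x := by
  obtain ⟨f, hf, hfA⟩ := exists_differentiableAt_smul hA hY hA0 h
  have h0 := hfA.self_of_nhds
  refine ⟨f x, fderiv ℝ f x, ?_, h0, fun v => ?_⟩
  · intro hf0
    exact hY0 (by rw [h0, hf0, zero_smul])
  · have := (hf.hasFDerivAt.smul hA.hasFDerivAt).congr_of_eventuallyEq hfA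
    rw [this.fderiv]
    simp

/-- Proportional fields of normalized hyperspheres are stationary in the same directions. -/
theorem fderiv_eq_zero_of_proportional {X : Type*} [NormedAddCommGroup X] [NormedSpace ℝ X]
    {B B' : X → PolySpace n} {x : X} (hB : DifferentiableAt ℝ B x) (hB' : DifferentiableAt ℝ B' x)
    (h1 : form (B x) (B x) = 1) (h1' : ∀ᶠ y in 𝓝 x, form (B' y) (B' y) = 1)
    (h : ∀ᶠ y in 𝓝 x, ∃ c : ℝ, B' y = c • B y) {v : X} (hv : fderiv ℝ B x v = 0) :
    fderiv ℝ B' x v = 0 := by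
  have hne : B x ≠ 0 := by rintro h0; simp [h0] at h1
  have hne' : B' x ≠ 0 := by
    intro h0
    have := h1'.self_of_nhds
    simp [h0] at this
  obtain ⟨f, f', hf, hfB, hd⟩ := exists_fderiv_eq_smul_add hB hB' hne hne' h
  -- With `B' = f B` and `dB(v) = 0`, the normalization of `B'` gives `f f'(v) = 0`: the factor is
  -- stationary too.
  have h2 := form_deriv_add hB'.hasFDerivAt hB'.hasFDerivAt h1' v
  rw [hd, hv, hfB] at h2
  simp only [smul_zero, zero_add, form_smul_left, form_smul_right, h1, mul_one] at h2
  have h3 : f' v = 0 := by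
    have : f * f' v = 0 := by linarith
    exact (mul_eq_zero.mp this).resolve_left hf
  rw [hd, hv, h3, smul_zero, zero_smul, add_zero]

/-- In local coordinates: a smooth field of points of a hypersurface and of normalized tangent
hyperspheres. -/
structure IsCoordFrame (Ω : Set (EuclideanSpace ℝ (Fin (n - 1))))
    (A B : EuclideanSpace ℝ (Fin (n - 1)) → PolySpace n) : Prop where
  isOpen : IsOpen Ω
  smooth_point : ContDiffOn ℝ ∞ A Ω
  smooth_sphere : ContDiffOn ℝ ∞ B Ω
  ne_zero : ∀ y ∈ Ω, A y ≠ 0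
  null : ∀ y ∈ Ω, form (A y) (A y) = 0
  injective : ∀ y ∈ Ω, ∀ v, fderiv ℝ A y v ∈ Submodule.span ℝ {A y} → v = 0
  unit : ∀ y ∈ Ω, form (B y) (B y) = 1
  incident : ∀ y ∈ Ω, form (A y) (B y) = 0
  tangent : ∀ y ∈ Ω, ∀ v, form (fderiv ℝ A y v) (B y) = 0

namespace IsCoordFrame

variable {Ω Ω' : Set (EuclideanSpace ℝ (Fin (n - 1)))}
  {A B A' B' : EuclideanSpace ℝ (Fin (n - 1)) → PolySpace n} {y : EuclideanSpace ℝ (Fin (n - 1))}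

theorem contDiffAt_point (h : IsCoordFrame Ω A B) (hy : y ∈ Ω) : ContDiffAt ℝ ∞ A y :=
  h.smooth_point.contDiffAt (h.isOpen.mem_nhds hy)

theorem contDiffAt_sphere (h : IsCoordFrame Ω A B) (hy : y ∈ Ω) : ContDiffAt ℝ ∞ B y :=
  h.smooth_sphere.contDiffAt (h.isOpen.mem_nhds hy)

theorem hasFDerivAt_point (h : IsCoordFrame Ω A B) (hy : y ∈ Ω) :
    HasFDerivAt A (fderiv ℝ A y) y :=
  ((h.contDiffAt_point hy).differentiableAt (by simp)).hasFDerivAt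

theorem hasFDerivAt_sphere (h : IsCoordFrame Ω A B) (hy : y ∈ Ω) :
    HasFDerivAt B (fderiv ℝ B y) y :=
  ((h.contDiffAt_sphere hy).differentiableAt (by simp)).hasFDerivAt

theorem hasFDerivAt_fderiv_point (h : IsCoordFrame Ω A B) (hy : y ∈ Ω) :
    HasFDerivAt (fderiv ℝ A) (fderiv ℝ (fderiv ℝ A) y) y :=
  (((h.contDiffAt_point hy).fderiv_right (m := 1) (by norm_cast)).differentiableAt
    (by simp)).hasFDerivAt

theorem hasFDerivAt_fderiv_sphere (h : IsCoordFrame Ω A B) (hy : y ∈ Ω) :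
    HasFDerivAt (fderiv ℝ B) (fderiv ℝ (fderiv ℝ B) y) y :=
  (((h.contDiffAt_sphere hy).fderiv_right (m := 1) (by norm_cast)).differentiableAt
    (by simp)).hasFDerivAt

theorem form_point_fderiv (h : IsCoordFrame Ω A B) (hy : y ∈ Ω) (v) :
    form (A y) (fderiv ℝ A y v) = 0 := by
  have := form_deriv_add (h.hasFDerivAt_point hy) (h.hasFDerivAt_point hy)
    ((h.isOpen.eventually_mem hy).mono h.null) v
  rw [form_comm] at this
  linarith

theorem isAdapted (h : IsCoordFrame Ω A B) (hy : y ∈ Ω) :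
    IsAdapted (A y) (fderiv ℝ A y).toLinearMap (B y) where
  ne_zero := h.ne_zero y hy
  null := h.null y hy
  injective := h.injective y hy
  orthogonal := h.form_point_fderiv hy
  unit := h.unit y hy
  incident := h.incident y hy
  tangent := h.tangent y hy

theorem form_point_fderiv_sphere (h : IsCoordFrame Ω A B) (hy : y ∈ Ω) (v) :
    form (A y) (fderiv ℝ B y v) = 0 := by
  have := form_deriv_add (h.hasFDerivAt_point hy) (h.hasFDerivAt_sphere hy)
    ((h.isOpen.eventually_mem hy).mono h.incident) v
  rwa [h.tangent y hy, zero_add] at this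

theorem form_sphere_fderiv_sphere (h : IsCoordFrame Ω A B) (hy : y ∈ Ω) (v) :
    form (B y) (fderiv ℝ B y v) = 0 := by
  have := form_deriv_add (h.hasFDerivAt_sphere hy) (h.hasFDerivAt_sphere hy)
    ((h.isOpen.eventually_mem hy).mono h.unit) v
  rw [form_comm] at this
  linarith

theorem hasFDerivAt_fderiv_point_apply (h : IsCoordFrame Ω A B) (hy : y ∈ Ω) (v) :
    HasFDerivAt (fun z => fderiv ℝ A z v) ((fderiv ℝ (fderiv ℝ A) y).flip v) y := by
  simpa using (h.hasFDerivAt_fderiv_point hy).clm_apply (hasFDerivAt_const v y)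

theorem hasFDerivAt_fderiv_sphere_apply (h : IsCoordFrame Ω A B) (hy : y ∈ Ω) (v) :
    HasFDerivAt (fun z => fderiv ℝ B z v) ((fderiv ℝ (fderiv ℝ B) y).flip v) y := by
  simpa using (h.hasFDerivAt_fderiv_sphere hy).clm_apply (hasFDerivAt_const v y)

theorem form_second_sphere (h : IsCoordFrame Ω A B) (hy : y ∈ Ω) (v w) :
    form (fderiv ℝ (fderiv ℝ A) y w v) (B y) = -form (fderiv ℝ A y v) (fderiv ℝ B y w) := by
  have := form_deriv_add (h.hasFDerivAt_fderiv_point_apply hy v) (h.hasFDerivAt_sphere hy)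
    ((h.isOpen.eventually_mem hy).mono fun z hz => h.tangent z hz v) w
  rw [ContinuousLinearMap.flip_apply] at this
  linarith

theorem form_second_point (h : IsCoordFrame Ω A B) (hy : y ∈ Ω) (v w) :
    form (fderiv ℝ (fderiv ℝ A) y w v) (A y) = -form (fderiv ℝ A y v) (fderiv ℝ A y w) := by
  have := form_deriv_add (h.hasFDerivAt_fderiv_point_apply hy v) (h.hasFDerivAt_point hy)
    ((h.isOpen.eventually_mem hy).mono fun z hz =>
      (form_comm _ _).trans (h.form_point_fderiv hz v)) w
  rw [ContinuousLinearMap.flip_apply] at this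
  linarith

theorem second_symm_point (h : IsCoordFrame Ω A B) (hy : y ∈ Ω) (v w) :
    fderiv ℝ (fderiv ℝ A) y v w = fderiv ℝ (fderiv ℝ A) y w v :=
  (h.contDiffAt_point hy).isSymmSndFDerivAt (by simp; norm_cast) v w

theorem second_symm_sphere (h : IsCoordFrame Ω A B) (hy : y ∈ Ω) (v w) :
    fderiv ℝ (fderiv ℝ B) y v w = fderiv ℝ (fderiv ℝ B) y w v :=
  (h.contDiffAt_sphere hy).isSymmSndFDerivAt (by simp; norm_cast) v w

/-- The second fundamental form is symmetric. -/
theorem form_symm (h : IsCoordFrame Ω A B) (hy : y ∈ Ω) (v w) :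
    form (fderiv ℝ A y v) (fderiv ℝ B y w) = form (fderiv ℝ A y w) (fderiv ℝ B y v) := by
  have h1 := h.form_second_sphere hy v w
  have h2 := h.form_second_sphere hy w v
  rw [h.second_symm_point hy v w] at h2
  linarith

theorem gram_symm (h : IsCoordFrame Ω A B) (hy : y ∈ Ω) :
    gram (fderiv ℝ B y) (fderiv ℝ A y) = gram (fderiv ℝ A y) (fderiv ℝ B y) := by
  ext i j
  exact (form_comm _ _).trans (h.form_symm hy _ _)

/-- Differentiating `(A, B) = 0` and `(B, B) = 1` makes `dB(v)` orthogonal to `A` and `B`;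
membership in the kernel makes it orthogonal to `dA`. -/
theorem fderiv_sphere_mem_span (h : IsCoordFrame Ω A B) (hn : 1 ≤ n) (hy : y ∈ Ω) {v}
    (hv : v ∈ nullSpace (fderiv ℝ A y) (fderiv ℝ B y)) :
    ∃ c : ℝ, fderiv ℝ B y v = c • A y := by
  obtain ⟨c, hc⟩ := Submodule.mem_span_singleton.mp
    ((h.isAdapted hy).mem_span hn (by simp) (h.form_point_fderiv_sphere hy v) hv
      (h.form_sphere_fderiv_sphere hy v))
  exact ⟨c, hc.symm⟩

theorem exists_orthogonal_ne_zero {E : Type*} [AddCommGroup E] [Module ℝ E]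
    [FiniteDimensional ℝ E] (K : Submodule ℝ E) (hK : 2 ≤ Module.finrank ℝ K) (φ : E →ₗ[ℝ] ℝ) :
    ∃ w ∈ K, w ≠ 0 ∧ φ w = 0 := by
  have h : LinearMap.ker (φ.domRestrict K) ≠ ⊥ :=
    LinearMap.ker_ne_bot_of_finrank_lt (by simp; omega)
  obtain ⟨w, hw, hw0⟩ := Submodule.exists_mem_ne_zero_of_ne_bot h
  exact ⟨w, w.2, by simpa using hw0, hw⟩

/-- If the second fundamental form of a field of tangent hyperspheres has a kernel of constant
dimension at least `2`, then the hypersphere is stationary in the directions of the kernel. -/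
theorem fderiv_sphere_eq_zero (h : IsCoordFrame Ω A B) (hn : 1 ≤ n) {m r : ℕ} (hm : 2 ≤ m)
    (hmr : n - 1 = m + r)
    (hrank : ∀ z ∈ Ω, Module.finrank ℝ (nullSpace (fderiv ℝ A z) (fderiv ℝ B z)) = m)
    (hy : y ∈ Ω) {v} (hv : v ∈ nullSpace (fderiv ℝ A y) (fderiv ℝ B y)) : fderiv ℝ B y v = 0 := by
  let E := EuclideanSpace ℝ (Fin (n - 1))
  -- The second fundamental form, up to sign, as a differentiable family of symmetric bilinear forms
  -- of constant rank.
  let N : E → E →L[ℝ] E →L[ℝ] ℝ := fun z =>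
    ((ContinuousLinearMap.compL ℝ E (PolySpace n) ℝ).flip (fderiv ℝ B z)).comp
      ((formL n).comp (fderiv ℝ A z))
  have hNapp : ∀ z v w, N z v w = form (fderiv ℝ A z v) (fderiv ℝ B z w) := fun z v w => rfl
  have hNker : ∀ z ∈ Ω, ∀ v, N z v = 0 ↔ v ∈ nullSpace (fderiv ℝ A z) (fderiv ℝ B z) := by
    intro z hz v
    rw [mem_nullSpace]
    constructor
    · intro h0 w
      rw [h.form_symm hz, ← hNapp, h0, zero_apply]
    · intro h0
      ext1 w
      rw [hNapp, h.form_symm hz, h0, zero_apply]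
  have hNd : HasFDerivAt N (fderiv ℝ N y) y := by
    refine DifferentiableAt.hasFDerivAt ?_
    refine DifferentiableAt.clm_comp ?_ ?_
    · exact ((ContinuousLinearMap.compL ℝ E (PolySpace n) ℝ).flip).differentiableAt.comp y
        (h.hasFDerivAt_fderiv_sphere hy).differentiableAt
    · exact (differentiableAt_const _).clm_comp (h.hasFDerivAt_fderiv_point hy).differentiableAt
  have hN' : ∀ w v z, fderiv ℝ N y w v z =
      form (fderiv ℝ (fderiv ℝ A) y w v) (fderiv ℝ B y z) +
        form (fderiv ℝ A y v) (fderiv ℝ (fderiv ℝ B) y w z) := by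
    intro w v z
    have h1 : HasFDerivAt (fun t => N t v z) ((((fderiv ℝ N y).flip v)).flip z) y := by
      have := (hNd.clm_apply (hasFDerivAt_const v y)).clm_apply (hasFDerivAt_const z y)
      simpa using this
    exact (form_deriv_eq (h.hasFDerivAt_fderiv_point_apply hy v)
      (h.hasFDerivAt_fderiv_sphere_apply hy z) h1 (Eventually.of_forall fun t => rfl) w).symm
  have hvanish : ∀ v ∈ nullSpace (fderiv ℝ A y) (fderiv ℝ B y),
      ∀ z ∈ nullSpace (fderiv ℝ A y) (fderiv ℝ B y), ∀ w, fderiv ℝ N y w v z = 0 := by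
    intro v hv z hz w
    refine deriv_symm_apply_ker (m := m) (r := r)
      (finrank_euclideanSpace_fin.trans hmr) hNd ?_
      (fun v w => h.form_symm hy v w) ((hNker y hy v).mpr hv) ((hNker y hy z).mpr hz) w
    filter_upwards [h.isOpen.eventually_mem hy] with t ht
    rw [← hrank t ht]
    have : LinearMap.ker (N t).toLinearMap = nullSpace (fderiv ℝ A t) (fderiv ℝ B t) := by
      ext v
      exact hNker t ht v
    rw [this]
  -- Here `m ≥ 2` enters: the kernel contains a nonzero `w` with `g(v, w) = 0`.
  obtain ⟨w, hw, hw0, hvw⟩ := exists_orthogonal_ne_zero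
    (nullSpace (fderiv ℝ A y) (fderiv ℝ B y)) (by rw [hrank y hy]; exact hm)
    ((formB n (fderiv ℝ A y v)) ∘ₗ (fderiv ℝ A y).toLinearMap)
  have hvw' : form (fderiv ℝ A y v) (fderiv ℝ A y w) = 0 := hvw
  obtain ⟨c, hc⟩ := h.fderiv_sphere_mem_span hn hy hv
  obtain ⟨c', hc'⟩ := h.fderiv_sphere_mem_span hn hy hw
  -- With `dB(v) = c A` and `dB(w) = c' A`, `e1` reads `-c g(w, w) + (dA(w), d²B(w, v)) = 0`. In
  -- `e2` the term `c' g(v, w)` drops out and leaves `(dA(w), d²B(v, w)) = 0`. The symmetry of `d²B`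
  -- gives `c g(w, w) = 0`.
  have e1 := hvanish w hw v hv w
  have e2 := hvanish w hw w hw v
  rw [hN', hc, form_smul_right, h.form_second_point hy] at e1
  rw [hN', hc', form_smul_right, h.form_second_point hy, h.second_symm_sphere hy v w,
    form_comm (fderiv ℝ A y w) (fderiv ℝ A y v), hvw'] at e2
  have hpos : 0 < form (fderiv ℝ A y w) (fderiv ℝ A y w) := (h.isAdapted hy).pos hw0
  have : c = 0 := by
    have : c * form (fderiv ℝ A y w) (fderiv ℝ A y w) = 0 := by linarith
    exact (mul_eq_zero.mp this).resolve_right hpos.ne'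
  rw [hc, this, zero_smul]

/-- The hyperspheres of an `r`-parameter family enveloped by a hypersurface of dimension greater
than `r` are stationary in the kernel of the second fundamental form. -/
theorem fderiv_comp_eq_zero (h : IsCoordFrame Ω A B) (hn : 1 ≤ n) {r : ℕ} (hr : r < n - 1)
    {b : EuclideanSpace ℝ (Fin r) → PolySpace n}
    {u : EuclideanSpace ℝ (Fin (n - 1)) → EuclideanSpace ℝ (Fin r)} (hBu : ∀ z ∈ Ω, B z = b (u z))
    (hu : ∀ z ∈ Ω, ContDiffAt ℝ ∞ u z) (hus : ∀ z ∈ Ω, Function.Surjective (fderiv ℝ u z))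
    (hb : ∀ z ∈ Ω, DifferentiableAt ℝ b (u z)) (hy : y ∈ Ω) {w}
    (hw : w ∈ nullSpace (fderiv ℝ A y) (fderiv ℝ B y)) : fderiv ℝ B y w = 0 := by
  have hdB : ∀ z ∈ Ω, fderiv ℝ B z = (fderiv ℝ b (u z)).comp (fderiv ℝ u z) := fun z hz => by
    have h1 := (hb z hz).hasFDerivAt.comp z ((hu z hz).differentiableAt (by simp)).hasFDerivAt
    refine (h1.congr_of_eventuallyEq ?_).fderiv
    exact (h.isOpen.eventually_mem hz).mono hBu
  obtain ⟨c, hc⟩ := h.fderiv_sphere_mem_span hn hy hw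
  by_contra hne
  have hc0 : c ≠ 0 := by
    rintro rfl
    exact hne (by rw [hc, zero_smul])
  -- As `r < n - 1`, the fibre of `u` through `y` has positive dimension; `γ` is a curve in it with
  -- a nonzero velocity `v`.
  have hker : LinearMap.ker (fderiv ℝ u y).toLinearMap ≠ ⊥ :=
    LinearMap.ker_ne_bot_of_finrank_lt (by simpa using hr)
  obtain ⟨v, hv, hv0⟩ := Submodule.exists_mem_ne_zero_of_ne_bot hker
  have hstrict : HasStrictFDerivAt u (fderiv ℝ u y) y :=
    (hu y hy).hasStrictFDerivAt (by simp)
  have hrange : (fderiv ℝ u y).range = ⊤ := LinearMap.range_eq_top.mpr (hus y hy)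
  let ψ := hstrict.implicitFunction u (fderiv ℝ u y) hrange (u y)
  let v' : LinearMap.ker (fderiv ℝ u y).toLinearMap := ⟨v, hv⟩
  let γ : ℝ → EuclideanSpace ℝ (Fin (n - 1)) := fun t => ψ (t • v')
  have hψ0 : ψ 0 = y := hstrict.implicitFunction_apply_image hrange
  have hγ0 : γ 0 = y := by simp [γ, hψ0]
  have hγd : HasDerivAt γ v 0 := by
    have h1 := (hstrict.to_implicitFunction hrange).hasFDerivAt
    have h2 : HasDerivAt (fun t : ℝ => t • v') v' 0 := by
      have := (hasDerivAt_id (0 : ℝ)).smul_const v'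
      rwa [one_smul] at this
    rw [← zero_smul ℝ v'] at h1
    exact h1.comp_hasDerivAt (0 : ℝ) h2
  have hγu : ∀ᶠ t in 𝓝 (0 : ℝ), u (γ t) = u y := by
    have h1 := hstrict.map_implicitFunction_eq hrange
    have h2 : Tendsto (fun t : ℝ => (u y, t • v')) (𝓝 0) (𝓝 (u y, 0)) := by
      refine Continuous.tendsto' (by fun_prop) _ _ (by simp)
    exact h2.eventually h1
  have hγΩ : ∀ᶠ t in 𝓝 (0 : ℝ), γ t ∈ Ω := by
    refine hγd.continuousAt.eventually_mem ?_
    rw [hγ0]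
    exact h.isOpen.mem_nhds hy
  have horth : ∀ᶠ t in 𝓝 (0 : ℝ), form (A (γ t)) (fderiv ℝ A y v) = 0 := by
    filter_upwards [hγu, hγΩ] with t htu htΩ
    -- At the point `γ t` some `w'` has the same image under `du` as `w` has at `y`, so `dB(w')`
    -- there is again `c A(y)`. It is orthogonal to `A (γ t)`, and two orthogonal null vectors are
    -- proportional.
    obtain ⟨w', hw'⟩ := hus _ htΩ (fderiv ℝ u y w)
    have h1 := h.form_point_fderiv_sphere htΩ w'
    rw [hdB _ htΩ, ContinuousLinearMap.comp_apply, hw', htu, ← ContinuousLinearMap.comp_apply,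
      ← hdB y hy, hc, form_smul_right] at h1
    have h2 : form (A y) (A (γ t)) = 0 := by
      rw [form_comm]; exact (mul_eq_zero.mp h1).resolve_left hc0
    obtain ⟨s, hs⟩ := Submodule.mem_span_singleton.mp
      (mem_span_of_orthogonal_null (h.ne_zero y hy) (h.null y hy) h2 (h.null _ htΩ))
    rw [← hs, form_smul_left, h.form_point_fderiv hy, mul_zero]
  have hAγ : HasDerivAt (A ∘ γ) (fderiv ℝ A y v) 0 := by
    have h1 := h.hasFDerivAt_point hy
    rw [← hγ0] at h1
    have h2 := h1.comp_hasDerivAt (0 : ℝ) hγd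
    rwa [hγ0] at h2
  -- Differentiating at `t = 0` gives `g(v, v) = 0`, which contradicts positivity.
  have := form_deriv_add hAγ.hasFDerivAt (hasFDerivAt_const (fderiv ℝ A y v) (0 : ℝ)) horth 1
  simp only [zero_apply, form_zero_right, add_zero] at this
  have hpos : 0 < form (fderiv ℝ A y v) (fderiv ℝ A y v) := (h.isAdapted hy).pos hv0
  simp at this
  exact hpos.ne' this

/-- Two fields of tangent hyperspheres whose second fundamental forms have a common kernel vector
agree up to sign. -/
theorem sphere_eq_or_eq_neg (h : IsCoordFrame Ω A B) (h' : IsCoordFrame Ω' A' B') (hn : 1 ≤ n)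
    (hAA' : ∀ z ∈ Ω ∩ Ω', ∃ c : ℝ, A' z = c • A z) (hy : y ∈ Ω) (hy' : y ∈ Ω') {v} (hv0 : v ≠ 0)
    (hv : v ∈ nullSpace (fderiv ℝ A y) (fderiv ℝ B y))
    (hv' : v ∈ nullSpace (fderiv ℝ A' y) (fderiv ℝ B' y)) : B' y = B y ∨ B' y = -B y := by
  have hev : ∀ᶠ z in 𝓝 y, z ∈ Ω ∩ Ω' := (h.isOpen.inter h'.isOpen).eventually_mem ⟨hy, hy'⟩
  have hfac : ∀ z ∈ Ω ∩ Ω', ∃ f : ℝ, ∃ f' : EuclideanSpace ℝ (Fin (n - 1)) →L[ℝ] ℝ, f ≠ 0 ∧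
      A' z = f • A z ∧ ∀ v, fderiv ℝ A' z v = f • fderiv ℝ A z v + f' v • A z := by
    rintro z ⟨hz, hz'⟩
    exact exists_fderiv_eq_smul_add (h.hasFDerivAt_point hz).differentiableAt
      (h'.hasFDerivAt_point hz').differentiableAt (h.ne_zero z hz) (h'.ne_zero z hz')
      (((h.isOpen.inter h'.isOpen).eventually_mem ⟨hz, hz'⟩).mono hAA')
  have hinc : ∀ z ∈ Ω ∩ Ω', form (A z) (B' z) = 0 := by
    intro z hz
    obtain ⟨f, f', hf0, hA, -⟩ := hfac z hz
    have := h'.incident z hz.2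
    rw [hA, form_smul_left] at this
    exact (mul_eq_zero.mp this).resolve_left hf0
  have htan : ∀ z ∈ Ω ∩ Ω', ∀ v, form (fderiv ℝ A z v) (B' z) = 0 := by
    intro z hz v
    obtain ⟨f, f', hf0, hA, hA'⟩ := hfac z hz
    have := h'.tangent z hz.2 v
    rw [hA', form_add_left, form_smul_left, form_smul_left, hinc z hz, mul_zero, add_zero] at this
    exact (mul_eq_zero.mp this).resolve_left hf0
  have hε : DifferentiableAt ℝ (fun z => form (B z) (B' z)) y :=
    ((formL n).hasFDerivAt_of_bilinear (h.hasFDerivAt_sphere hy)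
      (h'.hasFDerivAt_sphere hy')).differentiableAt
  have hB := (h.hasFDerivAt_sphere hy).differentiableAt
  have hB' := (h'.hasFDerivAt_sphere hy').differentiableAt
  obtain ⟨k, hk, hkA⟩ := exists_differentiableAt_smul
    (Y := fun z => B' z - form (B z) (B' z) • B z) (h.hasFDerivAt_point hy).differentiableAt
    (hB'.sub (hε.smul hB)) (h.ne_zero y hy) (by
      filter_upwards [hev] with z hz
      obtain ⟨k, hk⟩ := (h.isAdapted hz.1).exists_eq_add hn (by simp) (hinc z hz) (htan z hz)
      exact ⟨k, sub_eq_iff_eq_add'.mpr hk⟩)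
  -- Near `y` one has `B' = ε B + k A` with `ε = (B, B')`. Differentiating along `v` and pairing
  -- with `dA(v)` leaves only `k g(v, v)`, so `k = 0` at `y`; normalization then gives `ε² = 1`.
  have hd := ((hε.hasFDerivAt.smul hB.hasFDerivAt).add
    (hk.hasFDerivAt.smul (h.hasFDerivAt_point hy))).congr_of_eventuallyEq (f₁ := B') (by
      filter_upwards [hkA] with z hz
      exact sub_eq_iff_eq_add'.mp hz)
  have hdv := congrArg (fun l => l v) hd.fderiv
  simp only [add_apply, smul_apply, ContinuousLinearMap.smulRight_apply] at hdv
  obtain ⟨f, f', hf0, hA, hA'⟩ := hfac y ⟨hy, hy'⟩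
  have hAB' : form (A y) (fderiv ℝ B' y v) = 0 := by
    have := h'.form_point_fderiv_sphere hy' v
    rw [hA, form_smul_left] at this
    exact (mul_eq_zero.mp this).resolve_left hf0
  have hPB' : form (fderiv ℝ A y v) (fderiv ℝ B' y v) = 0 := by
    have := hv' v
    rw [hA', form_add_left, form_smul_left, form_smul_left, hAB', mul_zero, add_zero] at this
    exact (mul_eq_zero.mp this).resolve_left hf0
  have hpos : 0 < form (fderiv ℝ A y v) (fderiv ℝ A y v) := (h.isAdapted hy).pos hv0
  rw [hdv] at hPB'
  simp only [form_add_right, form_smul_right, hv v, h.tangent y hy,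
    form_comm (fderiv ℝ A y v) (A y), h.form_point_fderiv hy, mul_zero, add_zero, zero_add] at hPB'
  have hk0 : k y = 0 := (mul_eq_zero.mp hPB').resolve_right hpos.ne'
  have hBy : B' y = form (B y) (B' y) • B y := by
    have := hkA.self_of_nhds
    rw [hk0, zero_smul] at this
    exact sub_eq_zero.mp this
  have hsq : form (B y) (B' y) * form (B y) (B' y) = 1 := by
    have := h'.unit y hy'
    rw [hBy] at this
    simpa [h.unit y hy] using this
  rcases mul_self_eq_one_iff.mp hsq with h1 | h1
  · left; rw [hBy, h1, one_smul]
  · right; rw [hBy, h1, neg_one_smul]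

end IsCoordFrame

end CoordFrame

/-! ### Smooth dependence of the affinor and change of tangent hypersphere -/

section Shift

open Topology Filter Matrix

variable {E : Type*} [NormedAddCommGroup E] [NormedSpace ℝ E] {ι : Type*} [Fintype ι]

theorem contDiffAt_mul_entry {S T : E → Matrix ι ι ℝ} {x : E}
    (hS : ∀ i j, ContDiffAt ℝ ∞ (fun y => S y i j) x)
    (hT : ∀ i j, ContDiffAt ℝ ∞ (fun y => T y i j) x) (i j : ι) :
    ContDiffAt ℝ ∞ (fun y => (S y * T y) i j) x := by
  simp only [Matrix.mul_apply]
  exact ContDiffAt.sum fun k _ => (hS i k).mul (hT k j)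

variable [DecidableEq ι]

theorem contDiffAt_det {T : E → Matrix ι ι ℝ} {x : E}
    (hT : ∀ i j, ContDiffAt ℝ ∞ (fun y => T y i j) x) :
    ContDiffAt ℝ ∞ (fun y => (T y).det) x := by
  simp only [Matrix.det_apply]
  exact ContDiffAt.sum fun σ _ => (contDiffAt_prod fun i _ => hT _ _).const_smul _

theorem contDiffAt_inv_entry {T : E → Matrix ι ι ℝ} {x : E}
    (hT : ∀ i j, ContDiffAt ℝ ∞ (fun y => T y i j) x) (hx : (T x).det ≠ 0) (i j : ι) :
    ContDiffAt ℝ ∞ (fun y => (T y)⁻¹ i j) x := by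
  simp only [Matrix.inv_def, Matrix.smul_apply, Ring.inverse_eq_inv', smul_eq_mul,
    Matrix.adjugate_apply]
  refine ((contDiffAt_det hT).inv hx).mul (contDiffAt_det fun k l => ?_)
  by_cases hk : k = j
  · subst hk
    simpa using contDiffAt_const
  · simpa [Matrix.updateRow_ne hk] using hT k l

variable {n : ℕ}

theorem contDiffAt_form {f g : E → PolySpace n} {x : E} (hf : ContDiffAt ℝ ∞ f x)
    (hg : ContDiffAt ℝ ∞ g x) : ContDiffAt ℝ ∞ (fun y => form (f y) (g y)) x :=
  (formL n).isBoundedBilinearMap.contDiff.contDiffAt.comp x (hf.prodMk hg)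

namespace IsCoordFrame

variable {Ω : Set (EuclideanSpace ℝ (Fin (n - 1)))}
  {A B : EuclideanSpace ℝ (Fin (n - 1)) → PolySpace n} {y : EuclideanSpace ℝ (Fin (n - 1))}

theorem contDiffAt_shape (h : IsCoordFrame Ω A B) (hy : y ∈ Ω) (i j) :
    ContDiffAt ℝ ∞ (fun z => shape (fderiv ℝ A z) (fderiv ℝ B z) i j) y := by
  have hA : ∀ v, ContDiffAt ℝ ∞ (fun z => fderiv ℝ A z v) y := fun v =>
    ((h.contDiffAt_point hy).fderiv_right (by simp)).clm_apply contDiffAt_const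
  have hB : ∀ v, ContDiffAt ℝ ∞ (fun z => fderiv ℝ B z v) y := fun v =>
    ((h.contDiffAt_sphere hy).fderiv_right (by simp)).clm_apply contDiffAt_const
  refine contDiffAt_mul_entry (contDiffAt_inv_entry ?_ ?_) ?_ i j
  · exact fun i j => contDiffAt_form (hA _) (hA _)
  · exact (isUnit_det_of_pos (gram_pos (h.isAdapted hy))).ne_zero
  · exact fun i j => (contDiffAt_form (hA _) (hB _)).neg

theorem contDiffAt_trace_shape (h : IsCoordFrame Ω A B) (hy : y ∈ Ω) :
    ContDiffAt ℝ ∞ (fun z => (shape (fderiv ℝ A z) (fderiv ℝ B z)).trace) y := by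
  simp only [Matrix.trace, Matrix.diag]
  exact ContDiffAt.sum fun i _ => h.contDiffAt_shape hy i i

/-- The kernel dimension is the algebraic multiplicity of `μ` as an eigenvalue of `g⁻¹ λ`, whose
entries are smooth. -/
theorem contDiffAt_multiple_eigenvalue (h : IsCoordFrame Ω A B) {m : ℕ} (hm : 1 ≤ m)
    {μ : EuclideanSpace ℝ (Fin (n - 1)) → ℝ} (hμ : ContinuousOn μ Ω)
    (hmult : ∀ z ∈ Ω, Module.finrank ℝ
      (nullSpace (fderiv ℝ A z) (fderiv ℝ B z + μ z • fderiv ℝ A z)) = m) (hy : y ∈ Ω) :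
    ContDiffAt ℝ ∞ μ y := by
  refine contDiffAt_eigenvalue (T := fun z => shape (fderiv ℝ A z) (fderiv ℝ B z)) hm
    (h.contDiffAt_shape hy) (hμ.continuousAt (h.isOpen.mem_nhds hy)) ?_
  filter_upwards [h.isOpen.eventually_mem hy] with z hz
  have := rootMultiplicity_pencil (h.isAdapted hz) (h.gram_symm hz) 0 (μ z)
  rw [zero_smul, sub_zero, add_zero] at this
  exact this.trans (hmult z hz)

/-- Passage to another field of tangent hyperspheres. -/
theorem add_smul_point (h : IsCoordFrame Ω A B) {μ : EuclideanSpace ℝ (Fin (n - 1)) → ℝ}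
    (hμ : ∀ z ∈ Ω, ContDiffAt ℝ ∞ μ z) : IsCoordFrame Ω A (fun z => B z + μ z • A z) where
  isOpen := h.isOpen
  smooth_point := h.smooth_point
  smooth_sphere := fun z hz =>
    ((h.contDiffAt_sphere hz).add ((hμ z hz).smul (h.contDiffAt_point hz))).contDiffWithinAt
  ne_zero := h.ne_zero
  null := h.null
  injective := h.injective
  unit := fun z hz => by
    simp [h.unit z hz, form_comm (B z) (A z), h.incident z hz, h.null z hz]
  incident := fun z hz => by simp [h.incident z hz, h.null z hz]
  tangent := fun z hz v => by
    simp [h.tangent z hz, form_comm _ (A z), h.form_point_fderiv hz]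

/-- The two maps differ by the term `dμ · A`, and `A` is orthogonal to `dA`. -/
theorem nullSpace_add_smul_point (h : IsCoordFrame Ω A B)
    {μ : EuclideanSpace ℝ (Fin (n - 1)) → ℝ} (hy : y ∈ Ω) (hμ : DifferentiableAt ℝ μ y) :
    nullSpace (fderiv ℝ A y) (fderiv ℝ (fun z => B z + μ z • A z) y) =
      nullSpace (fderiv ℝ A y) (fderiv ℝ B y + μ y • fderiv ℝ A y) := by
  have hd := (h.hasFDerivAt_sphere hy).fun_add
    (hμ.hasFDerivAt.fun_smul (h.hasFDerivAt_point hy))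
  ext v
  rw [mem_nullSpace, mem_nullSpace]
  refine forall_congr' fun w => ?_
  rw [hd.fderiv]
  simp [form_comm _ (A y), h.form_point_fderiv hy]

end IsCoordFrame

end Shift

/-! ### Homogeneous coordinates of points and hyperspheres -/

section Represents

variable {n : ℕ}

theorem Represents.exists_smul {X Y : PolySpace n} {p : Projectivization ℝ (PolySpace n)}
    (hX : Represents X p) (hY : Represents Y p) : ∃ c : ℝ, Y = c • X := by
  obtain ⟨h1, rfl⟩ := hX
  obtain ⟨h2, h⟩ := hY
  obtain ⟨c, hc⟩ := (Projectivization.mk_eq_mk_iff' ℝ _ _ h2 h1).mp h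
  exact ⟨c, hc.symm⟩

theorem represents_rep (p : Projectivization ℝ (PolySpace n)) : Represents p.rep p :=
  ⟨p.rep_nonzero, p.mk_rep⟩

theorem Represents.neg {X : PolySpace n} {p : Projectivization ℝ (PolySpace n)}
    (hX : Represents X p) : Represents (-X) p := by
  obtain ⟨h, rfl⟩ := hX
  refine ⟨neg_ne_zero.mpr h, (Projectivization.mk_eq_mk_iff' ℝ _ _ _ _).mpr ⟨-1, ?_⟩⟩
  simp

theorem Represents.form_self_eq_zero {X : PolySpace n} {p : Point n} (hX : Represents X p.val) :
    form X X = 0 := by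
  obtain ⟨c, rfl⟩ := (represents_rep p.val).exists_smul hX
  simp [p.2]

/-- The hypersphere with given normalized coordinates. -/
theorem exists_hypersphere {X : PolySpace n} (hX : form X X = 1) :
    ∃ H : Hypersphere n, Represents X H.val := by
  have h0 : X ≠ 0 := by rintro rfl; simp at hX
  have hr : Represents X (Projectivization.mk ℝ X h0) := ⟨h0, rfl⟩
  obtain ⟨c, hc⟩ := hr.exists_smul (represents_rep _)
  refine ⟨⟨Projectivization.mk ℝ X h0, ?_⟩, hr⟩
  have hc0 : c ≠ 0 := by
    rintro rfl
    exact Projectivization.rep_nonzero _ (by rw [hc, zero_smul])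
  rw [hc]
  simp only [form_smul_left, form_smul_right, hX, mul_one]
  exact mul_self_pos.mpr hc0

end Represents

/-! ### Passage between the manifold and the coordinates of a chart -/

section Charts

open Topology Filter

variable {n : ℕ} {M : Type*} [TopologicalSpace M] [ChartedSpace (EuclideanSpace ℝ (Fin (n - 1))) M]
  {G : Type*} [NormedAddCommGroup G] [NormedSpace ℝ G]

/-- The differential of a vector-valued function, on the model space of the tangent spaces. -/
noncomputable def dmap (n : ℕ) {M : Type*} [TopologicalSpace M]
    [ChartedSpace (EuclideanSpace ℝ (Fin (n - 1))) M] {G : Type*} [NormedAddCommGroup G]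
    [NormedSpace ℝ G] (f : M → G) (x : M) : EuclideanSpace ℝ (Fin (n - 1)) →L[ℝ] G :=
  mfderiv (𝓡 (n - 1)) 𝓘(ℝ, G) f x

theorem dmap_congr {f g : M → G} {x : M} (h : f =ᶠ[𝓝 x] g) :
    dmap n f x = dmap n g x :=
  Filter.EventuallyEq.mfderiv_eq h

/-- The part of an open set covered by a chart, in the coordinates of this chart. -/
def coordDomain (x : M) (W : Set M) : Set (EuclideanSpace ℝ (Fin (n - 1))) :=
  (extChartAt (𝓡 (n - 1)) x).target ∩ (extChartAt (𝓡 (n - 1)) x).symm ⁻¹' W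

theorem isOpen_coordDomain (x : M) {W : Set M} (hW : IsOpen W) :
    IsOpen (coordDomain (n := n) x W) :=
  (continuousOn_extChartAt_symm x).isOpen_inter_preimage (isOpen_extChartAt_target x) hW

theorem extChartAt_mem_coordDomain {x : M} {W : Set M} {y : M}
    (hy : y ∈ (extChartAt (𝓡 (n - 1)) x).source) (hyW : y ∈ W) :
    extChartAt (𝓡 (n - 1)) x y ∈ coordDomain (n := n) x W :=
  ⟨(extChartAt (𝓡 (n - 1)) x).map_source hy, by
    rw [Set.mem_preimage, (extChartAt (𝓡 (n - 1)) x).left_inv hy]; exact hyW⟩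

theorem extChartAt_symm_mem_of_coordDomain {x : M} {W : Set M}
    {z : EuclideanSpace ℝ (Fin (n - 1))} (hz : z ∈ coordDomain (n := n) x W) :
    (extChartAt (𝓡 (n - 1)) x).symm z ∈ (extChartAt (𝓡 (n - 1)) x).source ∧
      (extChartAt (𝓡 (n - 1)) x).symm z ∈ W ∧
      extChartAt (𝓡 (n - 1)) x ((extChartAt (𝓡 (n - 1)) x).symm z) = z :=
  ⟨(extChartAt (𝓡 (n - 1)) x).map_target hz.1, hz.2, (extChartAt (𝓡 (n - 1)) x).right_inv hz.1⟩

theorem eventuallyEq_coord {Y : Type*} {x y : M}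
    (hy : y ∈ (extChartAt (𝓡 (n - 1)) x).source) (f : M → Y) :
    f =ᶠ[𝓝 y] (f ∘ (extChartAt (𝓡 (n - 1)) x).symm) ∘ extChartAt (𝓡 (n - 1)) x := by
  filter_upwards [(isOpen_extChartAt_source x).eventually_mem hy] with z hz
  simp only [Function.comp_apply, (extChartAt (𝓡 (n - 1)) x).left_inv hz]

variable [IsManifold (𝓡 (n - 1)) ∞ M]

/-- `D` is the differential of the chart at `y`. It is chosen before the functions, so the same `D`
serves `A`, `B` and the parameters `u`, as the comparison of their kernels and Gram matrices
demands. -/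
theorem exists_dmap_comp_extChartAt (x : M) {y : M} (hy : y ∈ (extChartAt (𝓡 (n - 1)) x).source) :
    ∃ D : EuclideanSpace ℝ (Fin (n - 1)) ≃L[ℝ] EuclideanSpace ℝ (Fin (n - 1)),
      ∀ {G : Type} [NormedAddCommGroup G] [NormedSpace ℝ G]
        (g : EuclideanSpace ℝ (Fin (n - 1)) → G) (f : M → G),
        DifferentiableAt ℝ g (extChartAt (𝓡 (n - 1)) x y) →
        f =ᶠ[𝓝 y] g ∘ extChartAt (𝓡 (n - 1)) x →
        dmap n f y = (fderiv ℝ g (extChartAt (𝓡 (n - 1)) x y)).comp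
          (D : EuclideanSpace ℝ (Fin (n - 1)) →L[ℝ] EuclideanSpace ℝ (Fin (n - 1))) := by
  have : IsManifold (𝓡 (n - 1)) 1 M := IsManifold.of_le (n := ∞) (by simp)
  obtain ⟨D, hD⟩ := isInvertible_mfderiv_extChartAt (I := 𝓡 (n - 1)) hy
  refine ⟨D, fun g f hg hfg => ?_⟩
  rw [dmap_congr hfg]
  have h1 : MDifferentiableAt (𝓡 (n - 1)) 𝓘(ℝ, EuclideanSpace ℝ (Fin (n - 1)))
      (extChartAt (𝓡 (n - 1)) x) y :=
    mdifferentiableAt_extChartAt (by rwa [extChartAt_source] at hy)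
  have h2 := mfderiv_comp y (I'' := 𝓘(ℝ, _)) hg.mdifferentiableAt h1
  rw [mfderiv_eq_fderiv, ← hD] at h2
  exact h2

theorem contDiffOn_coord (x : M) {W : Set M} {f : M → G}
    (hf : ContMDiffOn (𝓡 (n - 1)) 𝓘(ℝ, G) ∞ f W) :
    ContDiffOn ℝ ∞ (f ∘ (extChartAt (𝓡 (n - 1)) x).symm) (coordDomain x W) := by
  rw [← contMDiffOn_iff_contDiffOn]
  exact hf.comp ((contMDiffOn_extChartAt_symm x).mono Set.inter_subset_left) fun z hz => hz.2

theorem contMDiffOn_comp_extChartAt (x : M) {W : Set M}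
    (hW : W ⊆ (extChartAt (𝓡 (n - 1)) x).source) {Ω : Set (EuclideanSpace ℝ (Fin (n - 1)))}
    {g : EuclideanSpace ℝ (Fin (n - 1)) → G} (hg : ContDiffOn ℝ ∞ g Ω)
    (hWΩ : Set.MapsTo (extChartAt (𝓡 (n - 1)) x) W Ω) :
    ContMDiffOn (𝓡 (n - 1)) 𝓘(ℝ, G) ∞ (g ∘ extChartAt (𝓡 (n - 1)) x) W :=
  hg.contMDiffOn.comp ((contMDiffOn_extChartAt (x := x)).mono
    (by rwa [extChartAt_source] at hW)) hWΩ

end Charts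

/-! ### Frames on the hypersurface and the eigenvalues of `a_ij` -/

section Frames

open Topology Filter

variable {n : ℕ} {M : Type*} [TopologicalSpace M] [ChartedSpace (EuclideanSpace ℝ (Fin (n - 1))) M]
  {V : M → Point n} {W W' : Set M} {A A' B : M → PolySpace n} {x y : M}

theorem IsLift.mono (h : IsLift V W A) (hW' : IsOpen W') (hsub : W' ⊆ W) : IsLift V W' A where
  isOpen := hW'
  smooth := h.smooth.mono hsub
  represents := fun z hz => h.represents z (hsub hz)
  immersion := fun z hz => h.immersion z (hsub hz)

theorem IsFrame.mono (h : IsFrame V W A B) (hW' : IsOpen W') (hsub : W' ⊆ W) :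
    IsFrame V W' A B where
  lift := h.lift.mono hW' hsub
  smooth := h.smooth.mono hsub
  unit := fun z hz => h.unit z (hsub hz)
  incident := fun z hz => h.incident z (hsub hz)
  tangent := fun z hz => h.tangent z (hsub hz)

theorem aTensor_eq (A B : M → PolySpace n) (y : M) :
    aTensor A B y = -gram (dmap n A y) (dmap n B y) -
      (((n : ℝ) - 1)⁻¹ * (shape (dmap n A y) (dmap n B y)).trace) •
        gram (dmap n A y) (dmap n A y) := by
  have h1 : gTensor A y = gram (dmap n A y) (dmap n A y) := rfl
  have h2 : lamTensor A B y = -gram (dmap n A y) (dmap n B y) := rfl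
  rw [aTensor, h1, h2, shape]

theorem affinor_eq (A B : M → PolySpace n) (y : M) :
    affinor A B y = (gram (dmap n A y) (dmap n A y))⁻¹ * (-gram (dmap n A y) (dmap n B y) -
      (((n : ℝ) - 1)⁻¹ * (shape (dmap n A y) (dmap n B y)).trace) •
        gram (dmap n A y) (dmap n A y)) := by
  rw [affinor, aTensor_eq]
  rfl

variable [IsManifold (𝓡 (n - 1)) ∞ M]

theorem IsLift.differentiableAt_coord (h : IsLift V W A)
    (hy : y ∈ (extChartAt (𝓡 (n - 1)) x).source) (hyW : y ∈ W) :
    DifferentiableAt ℝ (A ∘ (extChartAt (𝓡 (n - 1)) x).symm) (extChartAt (𝓡 (n - 1)) x y) :=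
  ((contDiffOn_coord x h.smooth).contDiffAt ((isOpen_coordDomain x h.isOpen).mem_nhds
    (extChartAt_mem_coordDomain hy hyW))).differentiableAt (by simp)

theorem IsFrame.differentiableAt_coord (h : IsFrame V W A B)
    (hy : y ∈ (extChartAt (𝓡 (n - 1)) x).source) (hyW : y ∈ W) :
    DifferentiableAt ℝ (B ∘ (extChartAt (𝓡 (n - 1)) x).symm) (extChartAt (𝓡 (n - 1)) x y) :=
  ((contDiffOn_coord x h.smooth).contDiffAt ((isOpen_coordDomain x h.lift.isOpen).mem_nhds
    (extChartAt_mem_coordDomain hy hyW))).differentiableAt (by simp)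

/-- A frame in the coordinates of a chart. -/
theorem IsFrame.isCoordFrame (h : IsFrame V W A B) (x : M) :
    IsCoordFrame (coordDomain x W) (A ∘ (extChartAt (𝓡 (n - 1)) x).symm)
      (B ∘ (extChartAt (𝓡 (n - 1)) x).symm) := by
  have hd : ∀ z ∈ coordDomain (n := n) x W, ∀ v,
      ∃ v', (v' = 0 → v = 0) ∧ fderiv ℝ (A ∘ (extChartAt (𝓡 (n - 1)) x).symm) z v =
        dmap n A ((extChartAt (𝓡 (n - 1)) x).symm z) v' := by
    intro z hz v
    obtain ⟨hs, hW, hr⟩ := extChartAt_symm_mem_of_coordDomain hz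
    obtain ⟨D, hD⟩ := exists_dmap_comp_extChartAt x hs
    refine ⟨D.symm v, fun h0 => by simpa using h0, ?_⟩
    rw [hD _ _ (h.lift.differentiableAt_coord hs hW) (eventuallyEq_coord hs A), hr]
    simp
  refine ⟨isOpen_coordDomain x h.lift.isOpen, contDiffOn_coord x h.lift.smooth,
    contDiffOn_coord x h.smooth, fun z hz => (h.lift.represents _ hz.2).1,
    fun z hz => (h.lift.represents _ hz.2).form_self_eq_zero, fun z hz v hv => ?_,
    fun z hz => h.unit _ hz.2, fun z hz => h.incident _ hz.2, fun z hz v => ?_⟩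
  · obtain ⟨v', hv0, hv'⟩ := hd z hz v
    rw [hv'] at hv
    exact hv0 (h.lift.immersion _ hz.2 v' hv)
  · obtain ⟨v', hv0, hv'⟩ := hd z hz v
    rw [hv']
    exact h.tangent _ hz.2 v'

/-- The differentials of a frame in terms of the coordinates of a chart. -/
theorem IsFrame.exists_dmap_eq (h : IsFrame V W A B) (hy : y ∈ (extChartAt (𝓡 (n - 1)) x).source)
    (hyW : y ∈ W) :
    ∃ D : EuclideanSpace ℝ (Fin (n - 1)) ≃L[ℝ] EuclideanSpace ℝ (Fin (n - 1)),
      dmap n A y = (fderiv ℝ (A ∘ (extChartAt (𝓡 (n - 1)) x).symm)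
        (extChartAt (𝓡 (n - 1)) x y)).comp
          (D : EuclideanSpace ℝ (Fin (n - 1)) →L[ℝ] EuclideanSpace ℝ (Fin (n - 1))) ∧
      dmap n B y = (fderiv ℝ (B ∘ (extChartAt (𝓡 (n - 1)) x).symm)
        (extChartAt (𝓡 (n - 1)) x y)).comp
          (D : EuclideanSpace ℝ (Fin (n - 1)) →L[ℝ] EuclideanSpace ℝ (Fin (n - 1))) := by
  obtain ⟨D, hD⟩ := exists_dmap_comp_extChartAt x hy
  exact ⟨D, hD _ _ (h.lift.differentiableAt_coord hy hyW) (eventuallyEq_coord hy A),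
    hD _ _ (h.differentiableAt_coord hy hyW) (eventuallyEq_coord hy B)⟩

theorem IsFrame.isAdapted (h : IsFrame V W A B) (hy : y ∈ W) :
    IsAdapted (A y) (dmap n A y).toLinearMap (B y) where
  ne_zero := (h.lift.represents y hy).1
  null := (h.lift.represents y hy).form_self_eq_zero
  injective := h.lift.immersion y hy
  orthogonal := fun v => by
    obtain ⟨D, hD, -⟩ := h.exists_dmap_eq (mem_extChartAt_source y) hy
    have := (h.isCoordFrame y).form_point_fderiv
      (extChartAt_mem_coordDomain (mem_extChartAt_source y) hy) (D v)
    simp only [Function.comp_apply, extChartAt_to_inv] at this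
    rw [hD]
    exact this
  unit := h.unit y hy
  incident := h.incident y hy
  tangent := h.tangent y hy

theorem IsFrame.gram_symm (h : IsFrame V W A B) (hy : y ∈ W) :
    gram (dmap n B y) (dmap n A y) = gram (dmap n A y) (dmap n B y) := by
  obtain ⟨D, hA, hB⟩ := h.exists_dmap_eq (mem_extChartAt_source y) hy
  rw [hA, hB, gram_comp, gram_comp, (h.isCoordFrame y).gram_symm
    (extChartAt_mem_coordDomain (mem_extChartAt_source y) hy)]

/-- Multiplicity of an eigenvalue of the tensor `a_ij`, and its eigenspace. -/
theorem IsFrame.rootMultiplicity_affinor (h : IsFrame V W A B) (hy : y ∈ W) (a : ℝ) :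
    (affinor A B y).charpoly.rootMultiplicity a = Module.finrank ℝ (nullSpace (dmap n A y)
      (dmap n B y + (a + ((n : ℝ) - 1)⁻¹ * (shape (dmap n A y) (dmap n B y)).trace) •
        dmap n A y)) := by
  rw [affinor_eq]
  exact rootMultiplicity_pencil (h.isAdapted hy) (h.gram_symm hy) _ a

theorem IsFrame.affinor_mulVec_iff (h : IsFrame V W A B) (hy : y ∈ W) (a : ℝ)
    (v : EuclideanSpace ℝ (Fin (n - 1))) :
    (affinor A B y).mulVec v.ofLp = a • v.ofLp ↔ v ∈ nullSpace (dmap n A y)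
      (dmap n B y + (a + ((n : ℝ) - 1)⁻¹ * (shape (dmap n A y) (dmap n B y)).trace) •
        dmap n A y) := by
  rw [affinor_eq]
  exact mulVec_pencil_iff (h.isAdapted hy) _ a v

/-- Incidence and tangency of a hypersphere do not depend on the field of coordinates of the
points. -/
theorem IsLift.tangent_of_tangent (h : IsLift V W A) (h' : IsLift V W' A') (hy : y ∈ W)
    (hy' : y ∈ W') {X : PolySpace n} (h0 : form X (A' y) = 0)
    (h1 : ∀ v, form X (dmap n A' y v) = 0) :
    form X (A y) = 0 ∧ ∀ v, form X (dmap n A y v) = 0 := by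
  obtain ⟨D, hD⟩ := exists_dmap_comp_extChartAt y (mem_extChartAt_source (I := 𝓡 (n - 1)) y)
  have hs := mem_extChartAt_source (I := 𝓡 (n - 1)) y
  have hd := h.differentiableAt_coord hs hy
  have hd' := h'.differentiableAt_coord hs hy'
  have e := hD _ _ hd (eventuallyEq_coord hs A)
  have e' := hD _ _ hd' (eventuallyEq_coord hs A')
  have hprop : ∀ᶠ z in 𝓝 (extChartAt (𝓡 (n - 1)) y y), ∃ c : ℝ,
      (A ∘ (extChartAt (𝓡 (n - 1)) y).symm) z = c • (A' ∘ (extChartAt (𝓡 (n - 1)) y).symm) z := by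
    filter_upwards [(isOpen_coordDomain y (h.isOpen.inter h'.isOpen)).eventually_mem
      (extChartAt_mem_coordDomain hs ⟨hy, hy'⟩)] with z hz
    exact (h'.represents _ hz.2.2).exists_smul (h.represents _ hz.2.1)
  obtain ⟨f, f', -, hf, hff⟩ := exists_fderiv_eq_smul_add hd' hd
    (by simpa using (h'.represents y hy').1) (by simpa using (h.represents y hy).1) hprop
  simp only [Function.comp_apply, extChartAt_to_inv] at hf hff
  refine ⟨by rw [hf, form_smul_right, h0, mul_zero], fun v => ?_⟩
  have h2 := h1 v
  rw [e', ContinuousLinearMap.comp_apply] at h2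
  rw [e, ContinuousLinearMap.comp_apply, hff, form_add_right, form_smul_right, form_smul_right,
    h0, h2, mul_zero, mul_zero, add_zero]

end Frames

/-! ### The two implications -/

section Canal

open Topology Filter

variable {n m r : ℕ} {M : Type*} [TopologicalSpace M]
  [ChartedSpace (EuclideanSpace ℝ (Fin (n - 1))) M] [IsManifold (𝓡 (n - 1)) ∞ M]
  {V : M → Point n} {W W' : Set M} {A A' B B' : M → PolySpace n} {x y : M}

/-- A continuous eigenvalue of constant multiplicity determines a smooth field of tangent
hyperspheres whose second fundamental form vanishes on the eigenspaces. -/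
theorem IsFrame.exists_sphere_of_eigenvalue (h : IsFrame V W A B) (hm : 1 ≤ m) {a : M → ℝ}
    (ha : ContinuousOn a W)
    (hmult : ∀ y ∈ W, (affinor A B y).charpoly.rootMultiplicity (a y) = m) (hx : x ∈ W) :
    ∃ (W' : Set M) (B' : M → PolySpace n), x ∈ W' ∧ W' ⊆ W ∧ IsFrame V W' A B' ∧ ∀ y ∈ W',
      Module.finrank ℝ (nullSpace (dmap n A y) (dmap n B' y)) = m ∧
      ∀ v : EuclideanSpace ℝ (Fin (n - 1)), v ∈ nullSpace (dmap n A y) (dmap n B' y) ↔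
        (affinor A B y).mulVec v.ofLp = a y • v.ofLp := by
  have hc := h.isCoordFrame x
  set φ := extChartAt (𝓡 (n - 1)) x with hφ
  set A₁ := A ∘ φ.symm with hA₁
  set B₁ := B ∘ φ.symm with hB₁
  -- Adding back the trace removed from `a_ij` turns `a` into the eigenvalue `μ` of `g⁻¹ λ`; the
  -- hypersphere sought is `B + μ A`.
  let μ : EuclideanSpace ℝ (Fin (n - 1)) → ℝ := fun z =>
    a (φ.symm z) + ((n : ℝ) - 1)⁻¹ * (shape (fderiv ℝ A₁ z) (fderiv ℝ B₁ z)).trace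
  have htrace : ∀ y ∈ W, y ∈ φ.source → μ (φ y) =
      a y + ((n : ℝ) - 1)⁻¹ * (shape (dmap n A y) (dmap n B y)).trace := by
    intro y hy hys
    obtain ⟨D, hDA, hDB⟩ := h.exists_dmap_eq hys hy
    rw [hDA, hDB, trace_shape_comp]
    simp only [μ, φ.left_inv hys]
    rfl
  have hnull : ∀ y ∈ W, y ∈ φ.source → Module.finrank ℝ (nullSpace (fderiv ℝ A₁ (φ y))
      (fderiv ℝ B₁ (φ y) + μ (φ y) • fderiv ℝ A₁ (φ y))) = m := by
    intro y hy hys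
    obtain ⟨D, hDA, hDB⟩ := h.exists_dmap_eq hys hy
    have h1 := h.rootMultiplicity_affinor hy (a y)
    rw [hmult y hy, ← htrace y hy hys, hDA, hDB, ← ContinuousLinearMap.smul_comp,
      ← ContinuousLinearMap.add_comp, finrank_nullSpace_comp] at h1
    exact h1.symm
  have hμc : ContinuousOn μ (coordDomain x W) := by
    refine (ha.comp ((continuousOn_extChartAt_symm x).mono Set.inter_subset_left)
      fun z hz => hz.2).add (continuousOn_const.mul fun z hz => ?_)
    exact (hc.contDiffAt_trace_shape hz).continuousAt.continuousWithinAt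
  have hμ : ∀ z ∈ coordDomain x W, ContDiffAt ℝ ∞ μ z := fun z hz =>
    hc.contDiffAt_multiple_eigenvalue hm hμc (fun t ht => by
      obtain ⟨hs, hW, hr⟩ := extChartAt_symm_mem_of_coordDomain ht
      have := hnull _ hW hs
      rwa [hφ, hr] at this) hz
  have hc' := hc.add_smul_point hμ
  set B₂ : EuclideanSpace ℝ (Fin (n - 1)) → PolySpace n := fun z => B₁ z + μ z • A₁ z with hB₂
  have hopen : IsOpen (W ∩ φ.source) := h.lift.isOpen.inter (isOpen_extChartAt_source x)
  have hmaps : ∀ y ∈ W ∩ φ.source, φ y ∈ coordDomain x W := fun y hy =>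
    extChartAt_mem_coordDomain hy.2 hy.1
  have hA₁y : ∀ y ∈ W ∩ φ.source, A₁ (φ y) = A y := fun y hy => by
    simp only [hA₁, Function.comp_apply, φ.left_inv hy.2]
  have hframe : IsFrame V (W ∩ φ.source) A (B₂ ∘ φ) := by
    refine ⟨h.lift.mono hopen Set.inter_subset_left,
      contMDiffOn_comp_extChartAt x Set.inter_subset_right hc'.smooth_sphere hmaps,
      fun y hy => hc'.unit _ (hmaps y hy), fun y hy => ?_, fun y hy v => ?_⟩
    · have := hc'.incident _ (hmaps y hy)
      rwa [hA₁y y hy] at this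
    · obtain ⟨D, hDA, -⟩ := h.exists_dmap_eq hy.2 hy.1
      have := hc'.tangent _ (hmaps y hy) (D v)
      change form (dmap n A y v) _ = 0
      rw [hDA]
      exact this
  refine ⟨W ∩ φ.source, B₂ ∘ φ, ⟨hx, mem_extChartAt_source x⟩, Set.inter_subset_left, hframe,
    fun y hy => ?_⟩
  have hspace : nullSpace (dmap n A y) (dmap n (B₂ ∘ φ) y) = nullSpace (dmap n A y)
      (dmap n B y + (a y + ((n : ℝ) - 1)⁻¹ * (shape (dmap n A y) (dmap n B y)).trace) •
        dmap n A y) := by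
    obtain ⟨D, hD⟩ := exists_dmap_comp_extChartAt x hy.2
    have e1 := hD _ _ (h.lift.differentiableAt_coord hy.2 hy.1) (eventuallyEq_coord hy.2 A)
    have e2 := hD _ _ (h.differentiableAt_coord hy.2 hy.1) (eventuallyEq_coord hy.2 B)
    have e3 := hD B₂ (B₂ ∘ φ) (hc'.hasFDerivAt_sphere (hmaps y hy)).differentiableAt
      (EventuallyEq.refl _ _)
    rw [← htrace y hy.1 hy.2, e1, e2, e3, ← ContinuousLinearMap.smul_comp,
      ← ContinuousLinearMap.add_comp]
    ext v
    rw [nullSpace_comp, nullSpace_comp]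
    rw [← hφ, ← hA₁, ← hB₁, hc.nullSpace_add_smul_point (hmaps y hy)
      ((hμ _ (hmaps y hy)).differentiableAt (by simp))]
  rw [hspace]
  exact ⟨(h.rootMultiplicity_affinor hy.1 (a y)).symm.trans (hmult y hy.1),
    fun v => (h.affinor_mulVec_iff hy.1 (a y) v).symm⟩

/-- A field of tangent hyperspheres with a degenerate second fundamental form of constant corank
`m ≥ 2` is locally an `r`-parameter family. -/
theorem IsFrame.exists_isParameterFamilyOn (h : IsFrame V W A B) (hn : 1 ≤ n) (hm : 2 ≤ m)
    (hmr : n - 1 = m + r)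
    (hrank : ∀ y ∈ W, Module.finrank ℝ (nullSpace (dmap n A y) (dmap n B y)) = m)
    {S : M → Hypersphere n} (hS : ∀ y ∈ W, Represents (B y) (S y).val) (hx : x ∈ W) :
    ∃ W' : Set M, x ∈ W' ∧ IsOpen W' ∧ IsParameterFamilyOn r S W' := by
  have hc := h.isCoordFrame x
  set φ := extChartAt (𝓡 (n - 1)) x with hφ
  set A₁ := A ∘ φ.symm with hA₁
  set B₁ := B ∘ φ.symm with hB₁
  have hrank' : ∀ z ∈ coordDomain x W,
      Module.finrank ℝ (nullSpace (fderiv ℝ A₁ z) (fderiv ℝ B₁ z)) = m := by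
    intro z hz
    obtain ⟨hs, hW, hr⟩ := extChartAt_symm_mem_of_coordDomain hz
    obtain ⟨D, hDA, hDB⟩ := h.exists_dmap_eq hs hW
    have := hrank _ hW
    rw [hDA, hDB, finrank_nullSpace_comp, hr] at this
    exact this
  have hker : ∀ z ∈ coordDomain x W,
      Module.finrank ℝ (LinearMap.ker (fderiv ℝ B₁ z).toLinearMap) = m := by
    intro z hz
    -- The kernel of the second fundamental form is that of `dB`, so `dB` has constant rank `r`.
    have : LinearMap.ker (fderiv ℝ B₁ z).toLinearMap
        = nullSpace (fderiv ℝ A₁ z) (fderiv ℝ B₁ z) := by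
      ext v
      refine ⟨fun hv => ?_, fun hv => hc.fderiv_sphere_eq_zero hn hm hmr hrank' hz hv⟩
      have hv' : fderiv ℝ B₁ z v = 0 := hv
      rw [mem_nullSpace]
      intro w
      rw [hv', form_zero_right]
    rw [this, hrank' z hz]
  have hxφ : φ x ∈ coordDomain x W := extChartAt_mem_coordDomain (mem_extChartAt_source x) hx
  obtain ⟨U, b, u, Ω, hU, hb, hbi, hbB, hΩ, hxΩ, hΩW, hu, huU, hus, hBu⟩ :=
    exists_eq_immersion_comp_submersion (r := r) (finrank_euclideanSpace_fin.trans hmr)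
      hc.isOpen hc.smooth_sphere hker hxφ
  have hW'o : IsOpen (φ.source ∩ φ ⁻¹' Ω) :=
    (continuousOn_extChartAt x).isOpen_inter_preimage (isOpen_extChartAt_source x) hΩ
  refine ⟨φ.source ∩ φ ⁻¹' Ω, ⟨mem_extChartAt_source x, hxΩ⟩, hW'o, U, b, u ∘ φ, hU, hb, ?_, hbi,
    contMDiffOn_comp_extChartAt x Set.inter_subset_left hu fun y hy => hy.2,
    fun y hy => huU hy.2, fun y hy => ?_, fun y hy => ?_⟩
  · intro t ht
    obtain ⟨z, hz, hzt⟩ := hbB t ht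
    rw [hzt]
    exact hc.unit z hz
  · obtain ⟨D, hD⟩ := exists_dmap_comp_extChartAt x hy.1
    have e := hD u (u ∘ φ) ((hu.contDiffAt (hΩ.mem_nhds hy.2)).differentiableAt (by simp))
      (EventuallyEq.refl _ _)
    change Function.Surjective (dmap n (u ∘ φ) y)
    rw [e]
    exact (hus _ hy.2).comp D.surjective
  · have hyW : y ∈ W := by
      have := (hΩW hy.2).2
      rwa [Set.mem_preimage, φ.left_inv hy.1] at this
    have e := hBu _ hy.2
    simp only [hB₁, Function.comp_apply, φ.left_inv hy.1] at e
    rw [Function.comp_apply, ← e]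
    exact hS y hyW

theorem IsFrame.sphere_eq_or_eq_neg (h : IsFrame V W A B) (h' : IsFrame V W' A' B') (hn : 1 ≤ n)
    (hy : y ∈ W) (hy' : y ∈ W') {v : EuclideanSpace ℝ (Fin (n - 1))} (hv0 : v ≠ 0)
    (hv : v ∈ nullSpace (dmap n A y) (dmap n B y))
    (hv' : v ∈ nullSpace (dmap n A' y) (dmap n B' y)) : B' y = B y ∨ B' y = -B y := by
  have hs := mem_extChartAt_source (I := 𝓡 (n - 1)) y
  obtain ⟨D, hD⟩ := exists_dmap_comp_extChartAt y hs
  rw [hD _ _ (h.lift.differentiableAt_coord hs hy) (eventuallyEq_coord hs A),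
    hD _ _ (h.differentiableAt_coord hs hy) (eventuallyEq_coord hs B), nullSpace_comp] at hv
  rw [hD _ _ (h'.lift.differentiableAt_coord hs hy') (eventuallyEq_coord hs A'),
    hD _ _ (h'.differentiableAt_coord hs hy') (eventuallyEq_coord hs B'), nullSpace_comp] at hv'
  have := (h.isCoordFrame y).sphere_eq_or_eq_neg (h'.isCoordFrame y) hn
    (fun z hz => (h.lift.represents _ hz.1.2).exists_smul (h'.lift.represents _ hz.2.2))
    (extChartAt_mem_coordDomain hs hy) (extChartAt_mem_coordDomain hs hy')
    (by simpa using hv0) hv hv'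
  simpa using this

/-- The subspaces `L` do the gluing: the local hypersphere fields have the common kernel `L y`,
which is nonzero, so at `y` they define one projective point. -/
theorem isCanal_of_hasEigenvalueOfMultiplicity (hm : 2 ≤ m) (hmn : m ≤ n - 1)
    (hV : HasEigenvalueOfMultiplicity V m) : IsCanal V m := by
  obtain ⟨L, hL⟩ := hV
  have hn : 1 ≤ n := by omega
  have key : ∀ x : M, ∃ (W : Set M) (A B : M → PolySpace n), x ∈ W ∧ IsFrame V W A B ∧
      ∀ y ∈ W, Module.finrank ℝ (nullSpace (dmap n A y) (dmap n B y)) = m ∧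
        ∀ v : EuclideanSpace ℝ (Fin (n - 1)), v ∈ nullSpace (dmap n A y) (dmap n B y) ↔
          (v : TangentSpace (𝓡 (n - 1)) y) ∈ L y := by
    intro x
    obtain ⟨W, A, B, a, hx, hF, ha, hy⟩ := hL x
    obtain ⟨W', B', hx', hsub, hF', hW'⟩ := hF.exists_sphere_of_eigenvalue (by omega) ha
      (fun y hyW => (hy y hyW).1) hx
    exact ⟨W', A, B', hx', hF', fun y hy' => ⟨(hW' y hy').1, fun v =>
      ((hW' y hy').2 v).trans ((hy y (hsub hy')).2 v).symm⟩⟩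
  choose W A B hxW hF hW using key
  -- `S y` is read off from the frame chosen at `y` itself; `hSW` shows that every other frame
  -- around `y` gives the same hypersphere.
  choose S hS using fun x => exists_hypersphere ((hF x).unit x (hxW x))
  have hSW : ∀ x, ∀ y ∈ W x, Represents (B x y) (S y).val := by
    intro x y hy
    have hne : nullSpace (dmap n (A x) y) (dmap n (B x) y) ≠ ⊥ := by
      intro h0
      have := (hW x y hy).1
      rw [h0, finrank_bot] at this
      omega
    obtain ⟨v, hv, hv0⟩ := Submodule.exists_mem_ne_zero_of_ne_bot hne
    have hv' := ((hW y y (hxW y)).2 v).mpr (((hW x y hy).2 v).mp hv)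
    rcases (hF y).sphere_eq_or_eq_neg (hF x) hn (hxW y) hy hv0 hv' hv with h1 | h1
    · rw [h1]; exact hS y
    · rw [h1]; exact (hS y).neg
  refine ⟨S, fun x => ⟨W x, A x, hxW x, (hF x).lift, ?_⟩, fun x => ?_⟩
  · obtain ⟨c, hc⟩ := (hS x).exists_smul (represents_rep (S x).val)
    rw [hc]
    refine ⟨?_, fun v => ?_⟩
    · rw [form_smul_left, form_comm, (hF x).incident x (hxW x), mul_zero]
    · rw [form_smul_left, form_comm, (hF x).tangent x (hxW x), mul_zero]
  · exact (hF x).exists_isParameterFamilyOn hn hm (by omega) (fun y hy => (hW x y hy).1) (hSW x)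
      (hxW x)

/-- An enveloped family of normalized hyperspheres, together with a field of points, is a frame. -/
theorem IsLift.isFrame_of_family (hA : IsLift V W A)
    (hB : ContMDiffOn (𝓡 (n - 1)) 𝓘(ℝ, PolySpace n) ∞ B W)
    (hunit : ∀ y ∈ W, form (B y) (B y) = 1) {S : M → Hypersphere n}
    (hS : ∀ y, IsTangentAt V (S y) y) (hBS : ∀ y ∈ W, Represents (B y) (S y).val) :
    IsFrame V W A B := by
  have key : ∀ y ∈ W, form (B y) (A y) = 0 ∧ ∀ v, form (B y) (dmap n A y v) = 0 := by
    intro y hy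
    obtain ⟨W', A', hy', hA', h0, h1⟩ := hS y
    obtain ⟨c, hc⟩ := (represents_rep (S y).val).exists_smul (hBS y hy)
    obtain ⟨h2, h3⟩ := hA.tangent_of_tangent hA' hy hy' h0 h1
    rw [hc]
    exact ⟨by rw [form_smul_left, h2, mul_zero], fun v => by rw [form_smul_left, h3, mul_zero]⟩
  exact ⟨hA, hB, hunit, fun y hy => (form_comm _ _).trans (key y hy).1,
    fun y hy v => (form_comm _ _).trans ((key y hy).2 v)⟩

/-- The kernel of the second fundamental form of an enveloped `r`-parameter family. -/
theorem IsFrame.mem_nullSpace_iff_of_family (h : IsFrame V W A B) (hn : 1 ≤ n) (hm : 1 ≤ m)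
    (hmr : n - 1 = m + r) {b : EuclideanSpace ℝ (Fin r) → PolySpace n}
    {u : M → EuclideanSpace ℝ (Fin r)}
    (hu : ContMDiffOn (𝓡 (n - 1)) (𝓡 r) ∞ u W)
    (hus : ∀ y ∈ W, Function.Surjective (dmap n u y)) (hb : ∀ y ∈ W, DifferentiableAt ℝ b (u y))
    (hbi : ∀ y ∈ W, Function.Injective (fderiv ℝ b (u y))) (hBu : ∀ y ∈ W, B y = b (u y))
    (hy : y ∈ W) :
    (∀ v, v ∈ nullSpace (dmap n A y) (dmap n B y) ↔ dmap n B y v = 0) ∧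
      Module.finrank ℝ (nullSpace (dmap n A y) (dmap n B y)) = m := by
  have hc := h.isCoordFrame y
  have hs := mem_extChartAt_source (I := 𝓡 (n - 1)) y
  set φ := extChartAt (𝓡 (n - 1)) y with hφ
  have hu₁ : ∀ z ∈ coordDomain y W, ContDiffAt ℝ ∞ (u ∘ φ.symm) z := fun z hz =>
    (contDiffOn_coord y hu).contDiffAt (hc.isOpen.mem_nhds hz)
  have hyφ : φ y ∈ coordDomain y W := extChartAt_mem_coordDomain hs hy
  have hus₁ : ∀ z ∈ coordDomain y W, Function.Surjective (fderiv ℝ (u ∘ φ.symm) z) := by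
    intro z hz
    obtain ⟨hzs, hzW, hzr⟩ := extChartAt_symm_mem_of_coordDomain hz
    obtain ⟨D, hD⟩ := exists_dmap_comp_extChartAt y hzs
    rw [← hφ] at hzr hD
    have e := hD (u ∘ φ.symm) u (by rw [hzr]; exact (hu₁ z hz).differentiableAt (by simp))
      (eventuallyEq_coord hzs u)
    have hsurj := hus _ hzW
    rw [e, hzr] at hsurj
    intro t
    obtain ⟨v, hv⟩ := hsurj t
    exact ⟨D v, hv⟩
  obtain ⟨D, hD⟩ := exists_dmap_comp_extChartAt y hs
  have eA := hD _ _ (h.lift.differentiableAt_coord hs hy) (eventuallyEq_coord hs A)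
  have eB := hD _ _ (h.differentiableAt_coord hs hy) (eventuallyEq_coord hs B)
  have hiff : ∀ v, v ∈ nullSpace (dmap n A y) (dmap n B y) ↔ dmap n B y v = 0 := by
    intro v
    constructor
    · intro hv
      rw [eA, eB, nullSpace_comp] at hv
      rw [eB]
      exact hc.fderiv_comp_eq_zero hn (r := r) (by omega) (fun z hz => hBu _ hz.2) hu₁ hus₁
        (fun z hz => hb _ hz.2) hyφ hv
    · intro hv w
      rw [hv, form_zero_right]
  refine ⟨hiff, ?_⟩
  have hcomp : dmap n B y = (fderiv ℝ b (u y)).comp (dmap n u y) := by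
    have eu := hD _ _ ((hu₁ _ hyφ).differentiableAt (by simp)) (eventuallyEq_coord hs u)
    rw [eB, eu, ← ContinuousLinearMap.comp_assoc]
    congr 1
    have h1 : DifferentiableAt ℝ b ((u ∘ φ.symm) (φ y)) := by
      rw [Function.comp_apply, φ.left_inv hs]; exact hb y hy
    have h2 := h1.hasFDerivAt.comp (φ y) ((hu₁ _ hyφ).differentiableAt (by simp)).hasFDerivAt
    rw [Function.comp_apply, φ.left_inv hs] at h2
    refine (h2.congr_of_eventuallyEq ?_).fderiv
    filter_upwards [hc.isOpen.eventually_mem hyφ] with z hz using hBu _ hz.2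
  have hker : nullSpace (dmap n A y) (dmap n B y) = LinearMap.ker (dmap n u y).toLinearMap := by
    ext v
    rw [hiff, hcomp, ContinuousLinearMap.comp_apply]
    constructor
    · intro hv
      exact hbi y hy (hv.trans (map_zero _).symm)
    · intro hv
      have hv' : dmap n u y v = 0 := hv
      rw [hv', map_zero]
  have h3 := LinearMap.finrank_range_add_finrank_ker (dmap n u y).toLinearMap
  rw [LinearMap.range_eq_top.mpr (hus y hy), finrank_top, finrank_euclideanSpace_fin,
    finrank_euclideanSpace_fin] at h3
  rw [hker]
  omega

/-- Makes `ker dB` depend on the field `S` alone and not on the local family representing it, so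
that it can serve as the field `L`. -/
theorem dmap_eq_zero_of_represents (hW : IsOpen W) (hW' : IsOpen W') {S : M → Hypersphere n}
    (hB : ContMDiffOn (𝓡 (n - 1)) 𝓘(ℝ, PolySpace n) ∞ B W)
    (hB' : ContMDiffOn (𝓡 (n - 1)) 𝓘(ℝ, PolySpace n) ∞ B' W')
    (h1 : ∀ y ∈ W, form (B y) (B y) = 1) (h1' : ∀ y ∈ W', form (B' y) (B' y) = 1)
    (hS : ∀ y ∈ W, Represents (B y) (S y).val) (hS' : ∀ y ∈ W', Represents (B' y) (S y).val)
    (hy : y ∈ W) (hy' : y ∈ W') {v : EuclideanSpace ℝ (Fin (n - 1))} (hv : dmap n B y v = 0) :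
    dmap n B' y v = 0 := by
  have hs := mem_extChartAt_source (I := 𝓡 (n - 1)) y
  have hm := extChartAt_mem_coordDomain hs hy
  have hm' := extChartAt_mem_coordDomain hs hy'
  have hd := ((contDiffOn_coord y hB).contDiffAt
    ((isOpen_coordDomain y hW).mem_nhds hm)).differentiableAt (by simp)
  have hd' := ((contDiffOn_coord y hB').contDiffAt
    ((isOpen_coordDomain y hW').mem_nhds hm')).differentiableAt (by simp)
  obtain ⟨D, hD⟩ := exists_dmap_comp_extChartAt y hs
  rw [hD _ _ hd (eventuallyEq_coord hs B)] at hv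
  rw [hD _ _ hd' (eventuallyEq_coord hs B')]
  refine fderiv_eq_zero_of_proportional hd hd' (by simpa using h1 y hy) ?_ ?_ hv
  · filter_upwards [(isOpen_coordDomain y hW').eventually_mem hm'] with z hz using h1' _ hz.2
  · filter_upwards [(isOpen_coordDomain y (hW.inter hW')).eventually_mem
      (extChartAt_mem_coordDomain hs ⟨hy, hy'⟩)] with z hz
    exact (hS _ hz.2.1).exists_smul (hS' _ hz.2.2)

theorem hasEigenvalueOfMultiplicity_of_isCanal (hm : 2 ≤ m) (hmn : m ≤ n - 1)
    (hV : IsHypersurface V) (hC : IsCanal V m) : HasEigenvalueOfMultiplicity V m := by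
  obtain ⟨S, hS, hfam⟩ := hC
  have hn : 1 ≤ n := by omega
  choose W hxW hWo U b u hU hb hbu hbi hu huU hus hbS using hfam
  let B : M → M → PolySpace n := fun x => b x ∘ u x
  have hBW : ∀ x, ContMDiffOn (𝓡 (n - 1)) 𝓘(ℝ, PolySpace n) ∞ (B x) (W x) := fun x =>
    (hb x).contMDiffOn.comp (hu x) (huU x)
  have hB1 : ∀ x, ∀ y ∈ W x, form (B x y) (B x y) = 1 := fun x y hy => hbu x _ (huU x hy)
  refine ⟨fun x => LinearMap.ker (dmap n (B x) x).toLinearMap, fun x => ?_⟩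
  obtain ⟨W₀, A, hx₀, hA⟩ := hV x
  have hsrc := isOpen_extChartAt_source (I := 𝓡 (n - 1)) x
  have hF : IsFrame V (W₀ ∩ W x ∩ (extChartAt (𝓡 (n - 1)) x).source) A (B x) :=
    (hA.mono ((hA.isOpen.inter (hWo x)).inter hsrc) fun y hy => hy.1.1).isFrame_of_family
      ((hBW x).mono fun y hy => hy.1.2) (fun y hy => hB1 x y hy.1.2) hS
      (fun y hy => hbS x y hy.1.2)
  -- With the enveloped hypersphere as `Aₙ`, the form `λ` itself has the `m`-dimensional kernel. The
  -- eigenvalue `0` of `λ` becomes minus the mean of the trace for `a_ij`.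
  refine ⟨W₀ ∩ W x ∩ (extChartAt (𝓡 (n - 1)) x).source, A, B x,
    fun y => -(((n : ℝ) - 1)⁻¹ * (shape (dmap n A y) (dmap n (B x) y)).trace),
    ⟨⟨hx₀, hxW x⟩, mem_extChartAt_source x⟩, hF, ?_, fun y hy => ?_⟩
  · have hc := hF.isCoordFrame x
    have hcont : ContinuousOn (fun z => -(((n : ℝ) - 1)⁻¹ *
        (shape (fderiv ℝ (A ∘ (extChartAt (𝓡 (n - 1)) x).symm) z)
          (fderiv ℝ (B x ∘ (extChartAt (𝓡 (n - 1)) x).symm) z)).trace))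
        (coordDomain x (W₀ ∩ W x ∩ (extChartAt (𝓡 (n - 1)) x).source)) := fun z hz =>
      ((hc.contDiffAt_trace_shape hz).continuousAt.continuousWithinAt.const_mul _).neg
    refine (hcont.comp ((continuousOn_extChartAt x).mono Set.inter_subset_right)
      fun y hy => extChartAt_mem_coordDomain hy.2 hy).congr fun y hy => ?_
    obtain ⟨D, hDA, hDB⟩ := hF.exists_dmap_eq hy.2 hy
    simp only [Function.comp_apply]
    rw [hDA, hDB, trace_shape_comp]
  · obtain ⟨h1, h2⟩ := hF.mem_nullSpace_iff_of_family hn (by omega) (r := n - m - 1) (m := m)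
      (by omega) ((hu x).mono fun y hy => hy.1.2) (fun y hy => hus x y hy.1.2)
      (fun y hy => ((hb x).contDiffAt ((hU x).mem_nhds (huU x hy.1.2))).differentiableAt (by simp))
      (fun y hy => hbi x _ (huU x hy.1.2)) (fun y hy => rfl) hy
    refine ⟨?_, fun v => ?_⟩
    · rw [hF.rootMultiplicity_affinor hy, neg_add_cancel, zero_smul, add_zero, h2]
    · rw [hF.affinor_mulVec_iff hy, neg_add_cancel, zero_smul, add_zero, h1]
      exact ⟨fun hv => dmap_eq_zero_of_represents (hWo y) (hWo x) (hBW y) (hBW x) (hB1 y) (hB1 x)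
          (hbS y) (hbS x) (hxW y) hy.1.2 hv,
        fun hv => dmap_eq_zero_of_represents (hWo x) (hWo y) (hBW x) (hBW y) (hB1 x) (hB1 y)
          (hbS x) (hbS y) hy.1.2 (hxW y) hv⟩

end Canal

end Conformal

theorem theorem1 (n m : ℕ) (hm : 2 ≤ m) (hmn : m ≤ n - 1)
    {M : Type*} [TopologicalSpace M] [ChartedSpace (EuclideanSpace ℝ (Fin (n - 1))) M]
    [IsManifold (𝓡 (n - 1)) ∞ M]
    (V : M → Conformal.Point n) (hV : Conformal.IsHypersurface V) :
    Conformal.IsCanal V m ↔ Conformal.HasEigenvalueOfMultiplicity V m :=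
  ⟨Conformal.hasEigenvalueOfMultiplicity_of_isCanal hm hmn hV,
    Conformal.isCanal_of_hasEigenvalueOfMultiplicity hm hmn⟩
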